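/- Let $(B_t)_{t\ge 0}$ be a standard Brownian motion and let $\mu>0$. For $\nu\neq 0$ put $f^\nu(x)=-\frac{x}{\nu}+\frac{1-e^{-2\nu x}}{\nu(1-e^{-2\nu})}$ (the expected exit time from $]0,1[$ of a Brownian motion with drift $\nu$ started at $x\in[0,1]$), let $c^*(\mu)=\max_{x\in[0,1]}\bigl(f^\mu(x)-f^{-\mu}(x)\bigr)$, and let $0<c\le c^*(\mu)$. *Barriers.* If $c=c^*(\mu)$, put $$a_c=b_c=\frac{1}{2\mu}\left(\log\left(\tfrac{\sinh\mu}{\mu}\left(1-\sqrt{1-\tfrac{\mu^2}{\sinh^2\mu}}\right)\right)+\mu\right),\qquad a^{\max}_c=b^{\max}_c=1-a_c .$$ If $c<c^*(\mu)$, let $b_c$ be the unique solution $x\in[0,\frac12[$ of $$e^{4\mu x-2\mu}(2\mu x-\mu+c\mu^2-1)+2\mu x-\mu+c\mu^2+1=0,$$ put $\alpha_c=\frac{-e^{-\mu}}{2\mu^2\cosh(2\mu b_c-\mu)}$ and $\gamma_c=\alpha_ce^{2\mu}$, let $a_c$ be the unique solution $y\in\,]0,b_c[$ of $$\mu^2\alpha_ce^{4\mu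 y}+(1-2\mu^2\alpha_c)e^{2\mu y}-2\mu y+\mu^2\alpha_c-c\mu^2-1=0,$$ let $a^{\max}_c=1-b_c$, and let $b^{\max}_c$ be the unique solution $x\in\,]a^{\max}_c,1[$ of $$\gamma_c\mu^2e^{4\mu x-4\mu}+e^{2\mu x-2\mu}(1-2\gamma_c\mu^2)-2\mu x+2\mu-1+\gamma_c\mu^2+c\mu^2=0 .$$ *Threshold strategies.* Let $0<\ell\le h<1$, with $h<\frac12$ or $\ell>\frac12$, and put $D_1=[\ell,h]$, $D_{-1}=[1-h,1-\ell]$. For a starting position $x\in[0,1]$ and an initial drift direction $a\in\{-1,1\}$ define inductively $\tau_0=0$, $X^0_t=x+a\mu t+B_t-B_0$ and, for $n\ge 0$, $$\tau_{n+1}=\inf\{t\ge\tau_n: X^n_t\in D_{(-1)^na}\}\quad(\inf\emptyset=+\infty),$$ $$X^{n+1}_t=X^n_{\tau_{n+1}}+(-1)^{n+1}a\mu(t-\tau_{n+1})+B_t-B_{\tau_{n+1}}\quad(t\ge\tau_{n+1}).$$ The threshold strategy $S$ with these switching regions is $S_{0-}=a$ and $S_t=(-1)^na$ for $t\in[\tau_n,\tau_{n+1}[$.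 Let $A^c$ (expulsion) be the threshold strategy with $(\ell,h)=(a_c,b_c)$ and $G^c$ (confinement) the one with $(\ell,h)=(a^{\max}_c,b^{\max}_c)$. For such a strategy $S$, let $X^S_t=x+\mu\int_0^tS_s\,ds+B_t-B_0$ be the controlled position, $\tau^S=\inf\{t\ge 0:X^S_t\notin\,]0,1[\,\}$ the exit time, and $N_t(S)=\#\{s\in[0,t]:S_{s-}\ne S_s\}$ the number of switches up to time $t$ (a switch at time $0$ counts). Write $\mathbb E_{x,a}$ for the expectation when the start is $(x,a)$. Then for all $x\in[0,1]$ and $a\in\{-1,1\}$, $$\mathbb E_{x,a}\bigl(\tau^{A^c}\bigr)<\infty,\qquad \mathbb E_{x,a}\bigl(N_{\tau^{A^c}}(A^c)\bigr)<\infty,\qquad \mathbb E_{x,a}\bigl(\tau^{G^c}\bigr)<\infty,\qquad \mathbb E_{x,a}\bigl(N_{\tau^{G^c}}(G^c)\bigr)<\infty .$$ -/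

import Mathlib

open MeasureTheory ProbabilityTheory
open scoped NNReal ENNReal

noncomputable section

namespace DriftSwitching

/-! ### Controlled paths

A path of a strategy consists of its values `A t` for `t ≥ 0` together with the drift direction
`a` that applies just before time `0` (this is the value "at time `0-`"). -/

/-- The position at time `t`: the solution of `dX = A μ dt + dw`, `X 0 = x`, along the driving
path `w`. -/
def position (μ x : ℝ) (w A : ℝ≥0 → ℝ) (t : ℝ≥0) : ℝ :=
  x + μ * (∫ s in (0 : ℝ)..(t : ℝ), A s.toNNReal) + (w t - w 0)

/-- The first time at which the path `X` is not in the open interval `(0, 1)`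
(`∞` if there is no such time). -/
def exitTime (X : ℝ≥0 → ℝ) : ℝ≥0∞ :=
  sInf ((fun t : ℝ≥0 => (t : ℝ≥0∞)) '' {t | X t ∉ Set.Ioo (0 : ℝ) 1})

/-- The value `A (t-)`, with `A (0-) = a`. -/
def valueBefore (a : ℝ) (A : ℝ≥0 → ℝ) (t : ℝ≥0) : ℝ :=
  if t = 0 then a else Function.leftLim A t

/-- The number of switches in the time interval `[0, T]`, where `T = ∞` is allowed. -/
def numSwitches (a : ℝ) (A : ℝ≥0 → ℝ) (T : ℝ≥0∞) : ℕ∞ :=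
  {s : ℝ≥0 | (s : ℝ≥0∞) ≤ T ∧ valueBefore a A s ≠ A s}.encard

/-! ### Threshold strategies -/

/-- The switching region for the drift direction `d ∈ {-1, 1}`:
`[lo, hi]` for `d = 1`, and its mirror image `[1 - hi, 1 - lo]` for `d = -1`. -/
def switchRegion (lo hi d : ℝ) : Set ℝ :=
  if d = 1 then Set.Icc lo hi else Set.Icc (1 - hi) (1 - lo)

/-- The `n`-th switching time `τ n` (`τ 0 = 0`), paired with the auxiliary path `X n` that has
drift `(-1) ^ n * a * μ` from time `τ n` on and continues `X (n - 1)` from its value at `τ n`.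
The path `X n` is meaningful on `[τ n, ∞)` when `τ n` is finite. -/
def stage (lo hi μ x a : ℝ) (w : ℝ≥0 → ℝ) : ℕ → ℝ≥0∞ × (ℝ≥0 → ℝ)
  | 0 => (0, fun t => x + a * μ * (t : ℝ) + (w t - w 0))
  | n + 1 =>
    let τ : ℝ≥0∞ := (stage lo hi μ x a w n).1
    let X : ℝ≥0 → ℝ := (stage lo hi μ x a w n).2
    let τ' : ℝ≥0∞ := sInf ((fun t : ℝ≥0 => (t : ℝ≥0∞)) ''
      {t | τ ≤ (t : ℝ≥0∞) ∧ X t ∈ switchRegion lo hi ((-1) ^ n * a)})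
    (τ', fun t => X τ'.toNNReal + (-1) ^ (n + 1) * a * μ * ((t : ℝ) - (τ'.toNNReal : ℝ))
      + (w t - w τ'.toNNReal))

/-- The `n`-th switching time of the threshold strategy. -/
def switchTime (lo hi μ x a : ℝ) (w : ℝ≥0 → ℝ) (n : ℕ) : ℝ≥0∞ :=
  (stage lo hi μ x a w n).1

/-- The threshold strategy with switching regions `[lo, hi]` and `[1 - hi, 1 - lo]`, started
from the position `x` and the drift direction `a`, along the driving path `w`: its value is
`(-1) ^ n * a` on the time interval from `τ n` (included) to `τ (n + 1)` (excluded). -/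
def thresholdStrategy (lo hi μ x a : ℝ) (w : ℝ≥0 → ℝ) (t : ℝ≥0) : ℝ :=
  (-1) ^ (sSup {n : ℕ | switchTime lo hi μ x a w n ≤ (t : ℝ≥0∞)}) * a

/-! ### The critical cost and the barriers -/

/-- The expected exit time from `(0, 1)`, from the position `x`, of a Brownian motion with
constant drift `ν ≠ 0`. -/
def meanExit (ν x : ℝ) : ℝ :=
  -x / ν + (1 - Real.exp (-2 * ν * x)) / (ν * (1 - Real.exp (-2 * ν)))

/-- The critical cost `c*(μ)`, the maximum over `x ∈ [0, 1]` of the difference between the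
expected exit times for the drifts `μ` and `-μ`. -/
def criticalCost (μ : ℝ) : ℝ :=
  sSup ((fun x => meanExit μ x - meanExit (-μ) x) '' Set.Icc (0 : ℝ) 1)

/-- The point at which the maximum in the definition of `c*(μ)` is attained. -/
def criticalPoint (μ : ℝ) : ℝ :=
  1 / (2 * μ) *
    (Real.log (Real.sinh μ / μ * (1 - Real.sqrt (1 - μ ^ 2 / Real.sinh μ ^ 2))) + μ)

/-- The barrier `b_c`, for `0 < c ≤ c*(μ)`. -/
def barrierB (μ c : ℝ) : ℝ :=
  if c = criticalCost μ then criticalPoint μ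
  else Classical.epsilon fun x : ℝ => x ∈ Set.Ico (0 : ℝ) (1 / 2) ∧
    Real.exp (4 * μ * x - 2 * μ) * (2 * μ * x - μ + c * μ ^ 2 - 1)
      + 2 * μ * x - μ + c * μ ^ 2 + 1 = 0

/-- The constant `α_c`. -/
def alphaC (μ c : ℝ) : ℝ :=
  -Real.exp (-μ) / (2 * μ ^ 2 * Real.cosh (2 * μ * barrierB μ c - μ))

/-- The barrier `a_c`, for `0 < c ≤ c*(μ)`. -/
def barrierA (μ c : ℝ) : ℝ :=
  if c = criticalCost μ then criticalPoint μ
  else Classical.epsilon fun y : ℝ => y ∈ Set.Ioo (0 : ℝ) (barrierB μ c) ∧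
    μ ^ 2 * alphaC μ c * Real.exp (4 * μ * y)
      + (1 - 2 * μ ^ 2 * alphaC μ c) * Real.exp (2 * μ * y)
      - 2 * μ * y + μ ^ 2 * alphaC μ c - c * μ ^ 2 - 1 = 0

/-- The constant `γ_c`. -/
def gammaC (μ c : ℝ) : ℝ :=
  alphaC μ c * Real.exp (2 * μ)

/-- The barrier `a_c` of the confinement problem, for `0 < c ≤ c*(μ)`. -/
def barrierAMax (μ c : ℝ) : ℝ :=
  1 - barrierB μ c

/-- The barrier `b_c` of the confinement problem, for `0 < c ≤ c*(μ)`. -/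
def barrierBMax (μ c : ℝ) : ℝ :=
  if c = criticalCost μ then 1 - criticalPoint μ
  else Classical.epsilon fun x : ℝ => x ∈ Set.Ioo (barrierAMax μ c) (1 : ℝ) ∧
    gammaC μ c * μ ^ 2 * Real.exp (4 * μ * x - 4 * μ)
      + Real.exp (2 * μ * x - 2 * μ) * (1 - 2 * gammaC μ c * μ ^ 2)
      - 2 * μ * x + 2 * μ - 1 + gammaC μ c * μ ^ 2 + c * μ ^ 2 = 0

/-- The candidate strategy `A^c` for the expulsion problem. -/
def expulsion (μ c x a : ℝ) (w : ℝ≥0 → ℝ) : ℝ≥0 → ℝ :=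
  thresholdStrategy (barrierA μ c) (barrierB μ c) μ x a w

/-- The candidate strategy `G^c` for the confinement problem. -/
def confinement (μ c x a : ℝ) (w : ℝ≥0 → ℝ) : ℝ≥0 → ℝ :=
  thresholdStrategy (barrierAMax μ c) (barrierBMax μ c) μ x a w

/-! ### Exit times and numbers of switches as random variables

Here `S` assigns to a driving path the corresponding path of the strategy. -/

variable {Ω : Type*}

/-- The exit time `τ^S` of the controlled particle. -/
def controlledExitTime (μ x : ℝ) (S : (ℝ≥0 → ℝ) → ℝ≥0 → ℝ) (B : ℝ≥0 → Ω → ℝ) (ω : Ω) : ℝ≥0∞ :=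
  exitTime (position μ x (fun t => B t ω) (S fun t => B t ω))

/-- The number `N_{τ^S}(S)` of switches up to the exit time. -/
def switchesUntilExit (μ x a : ℝ) (S : (ℝ≥0 → ℝ) → ℝ≥0 → ℝ) (B : ℝ≥0 → Ω → ℝ) (ω : Ω) : ℝ≥0∞ :=
  (numSwitches a (S fun t => B t ω) (controlledExitTime μ x S B ω) : ℝ≥0∞)

/-- A `[0, ∞]`-valued random variable has a finite expectation (measurability up to null sets
is included). -/
def HasFiniteExpectation [MeasurableSpace Ω] (P : Measure Ω) (f : Ω → ℝ≥0∞) : Prop :=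
  AEMeasurable f P ∧ ∫⁻ ω, f ω ∂P < ∞

end DriftSwitching

end

/-!
The two switching regions are mirror images of each other, and since `b_c < 1/2`
(`DriftSwitching.barrierB_lt_half`) they lie on different sides of the midpoint, at some distance
`δ > 0` from each other, for `A^c` as for `G^c`. This separation is all that the argument uses of
the barriers, and
`DriftSwitching.hasFiniteExpectation_thresholdStrategy` proves the claim for every threshold
strategy with separated regions.

*Barriers.* With `u = μ - 2μx`, the difference of the two mean exit times is
`(u - μ sinh u / sinh μ) / μ²`, and the equation for `b_c` reads `u - tanh u = c μ²`. The maximum of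
the former is at most `(μ - tanh μ) / μ²`, hence for `c ≤ c*(μ)` the latter has a root `u ∈ (0, μ]`
by the intermediate value theorem, and `b_c = (μ - u) / (2μ) < 1/2`.

*Exit time.* Cut time into blocks of a fixed length `η`. Whatever the strategy does, the drift
moves the particle by at most `μη` in a block, so an increment of the Brownian motion larger than
`1 + μη` over a block forces an exit. The increments are independent, so the particle survives `k`
blocks with probability at most `q ^ k`, with `q < 1`. Summing over `k` bounds the mean exit time.

*Number of switches.* Between two consecutive switches the particle crosses from one region to the
other, hence moves by at least `δ`. If `μη ≤ δ/2`, the Brownian path itself moves by at least `δ/2`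
between consecutive switches in the same block, and the number of switches in a block is at most one
more than the number of oscillations of size `δ/8` that a greedy count along fine grids sees
(`DriftSwitching.le_oscillations`). The potential `θ² · count + displacement²` of the greedy count
grows in mean by at most the time elapsed, so that a block has at most `η/θ²` oscillations in mean
(`DriftSwitching.lintegral_oscillations_le`); no optional stopping is needed. The oscillations in the
`k`-th block are independent of the increments over the earlier blocks, whence
`E N ≤ ∑ q ^ k (1 + η/θ²) < ∞`.

*Measurability.* After replacing the Brownian motion by one with measurable values and continuous
paths everywhere, hitting times of closed sets by continuous processes are measurable, and this
passes inductively to the switching times, to the strategy and to the exit time.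
-/

namespace DriftSwitching

/-! ### The barriers lie on one side of the midpoint -/

/-- In the variable `u = μ - 2μx`, the gain of one switch is `(u - μ sinh u / sinh μ) / μ²`. -/
lemma meanExit_sub_meanExit_neg {μ : ℝ} (hμ : 0 < μ) (x : ℝ) :
    μ ^ 2 * (meanExit μ x - meanExit (-μ) x) =
      (μ - 2 * μ * x) - μ * Real.sinh (μ - 2 * μ * x) / Real.sinh μ := by
  have hq : 1 < Real.exp μ := Real.one_lt_exp_iff.2 hμ
  have hp : 0 < Real.exp (μ * x) := Real.exp_pos _
  have hq2 : Real.exp μ ^ 2 - 1 ≠ 0 := by nlinarith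
  have hq2' : 1 - Real.exp μ ^ 2 ≠ 0 := by nlinarith
  have e1 : Real.exp (-2 * μ * x) = (Real.exp (μ * x) ^ 2)⁻¹ := by
    rw [← Real.exp_nat_mul, ← Real.exp_neg]; congr 1; push_cast; ring
  have e2 : Real.exp (-2 * μ) = (Real.exp μ ^ 2)⁻¹ := by
    rw [← Real.exp_nat_mul, ← Real.exp_neg]; congr 1; push_cast; ring
  have e3 : Real.exp (-2 * -μ * x) = Real.exp (μ * x) ^ 2 := by
    rw [← Real.exp_nat_mul]; congr 1; push_cast; ring
  have e4 : Real.exp (-2 * -μ) = Real.exp μ ^ 2 := by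
    rw [← Real.exp_nat_mul]; congr 1; push_cast; ring
  have e5 : Real.exp (μ - 2 * μ * x) = Real.exp μ / Real.exp (μ * x) ^ 2 := by
    rw [← Real.exp_nat_mul, ← Real.exp_sub]; congr 1; push_cast; ring
  have e6 : Real.exp (-(μ - 2 * μ * x)) = Real.exp (μ * x) ^ 2 / Real.exp μ := by
    rw [← Real.exp_nat_mul, ← Real.exp_sub]; congr 1; push_cast; ring
  rw [meanExit, meanExit, Real.sinh_eq, Real.sinh_eq, e1, e2, e3, e4, e5, e6, Real.exp_neg]
  generalize Real.exp μ = q at *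
  generalize Real.exp (μ * x) = p at *
  have hq0 : q ≠ 0 := by positivity
  have h1 : 1 - (q ^ 2)⁻¹ = (q ^ 2 - 1) / q ^ 2 := by field_simp
  have h2 : (q - q⁻¹) / 2 = (q ^ 2 - 1) / (2 * q) := by field_simp
  have h3 : (1 : ℝ) - q ^ 2 = -(q ^ 2 - 1) := by ring
  rw [h1, h2, h3]
  field_simp
  ring

lemma convexOn_sinh : ConvexOn ℝ (Set.Ici 0) Real.sinh := by
  refine MonotoneOn.convexOn_of_deriv (convex_Ici 0) Real.continuous_sinh.continuousOn
    Real.differentiable_sinh.differentiableOn ?_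
  rw [interior_Ici, Real.deriv_sinh]
  intro x hx y hy hxy
  rw [Set.mem_Ioi] at hx hy
  exact Real.cosh_le_cosh.2 (by rwa [abs_of_pos hx, abs_of_pos hy])

lemma sinh_tangent_le {u v : ℝ} (hu : 0 ≤ u) (hv : 0 ≤ v) :
    Real.sinh v + Real.cosh v * (u - v) ≤ Real.sinh u := by
  rcases lt_trichotomy u v with h | rfl | h
  · have := convexOn_sinh.slope_le_of_hasDerivAt hu hv h (Real.hasDerivAt_sinh v)
    rw [slope_def_field, div_le_iff₀ (by linarith)] at this
    nlinarith
  · simp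
  · have := convexOn_sinh.le_slope_of_hasDerivAt hv hu h (Real.hasDerivAt_sinh v)
    rw [slope_def_field, le_div_iff₀ (by linarith)] at this
    nlinarith

lemma mul_sinh_le {μ u : ℝ} (hμ : 0 < μ) (hu : 0 ≤ u) (huμ : u ≤ μ) :
    μ * Real.sinh u ≤ u * Real.sinh μ := by
  have hle : u / μ ≤ 1 := (div_le_one hμ).2 huμ
  have h := convexOn_sinh.2 (Set.mem_Ici.2 hμ.le) Set.self_mem_Ici
    (show 0 ≤ u / μ by positivity) (sub_nonneg.2 hle) (by ring)
  simp only [smul_eq_mul, mul_zero, add_zero, Real.sinh_zero] at h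
  rw [div_mul_cancel₀ _ hμ.ne', div_mul_eq_mul_div, le_div_iff₀ hμ] at h
  linarith

lemma sub_sinh_div_cosh_monotoneOn :
    MonotoneOn (fun u : ℝ => u - Real.sinh u / Real.cosh u) (Set.Ici 0) := by
  have hd (u : ℝ) : HasDerivAt (fun u : ℝ => u - Real.sinh u / Real.cosh u)
      (1 - (Real.cosh u * Real.cosh u - Real.sinh u * Real.sinh u) / Real.cosh u ^ 2) u :=
    (hasDerivAt_id u).sub ((Real.hasDerivAt_sinh u).div (Real.hasDerivAt_cosh u)
      (Real.cosh_pos u).ne')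
  refine (monotone_of_deriv_nonneg (fun u => (hd u).differentiableAt) fun u => ?_).monotoneOn _
  rw [(hd u).deriv, sub_nonneg, div_le_one (by positivity)]
  nlinarith [sq_nonneg (Real.sinh u)]

/-- The maximum of `u - μ sinh u / sinh μ` is `v - tanh v` with `cosh v = sinh μ / μ`, and
`v ≤ μ` because `sinh μ / μ ≤ cosh μ`. -/
lemma sub_sinh_le {μ u : ℝ} (hμ : 0 < μ) (hu : u ∈ Set.Icc (-μ) μ) :
    u - μ * Real.sinh u / Real.sinh μ ≤ μ - Real.sinh μ / Real.cosh μ := by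
  have hs : 0 < Real.sinh μ := Real.sinh_pos_iff.2 hμ
  have hnn {w : ℝ} (hw : 0 ≤ w) : 0 ≤ w - Real.sinh w / Real.cosh w := by
    simpa using sub_sinh_div_cosh_monotoneOn (Set.self_mem_Ici) hw hw
  rcases le_total u 0 with h0 | h0
  · have h1 := mul_sinh_le hμ (u := -u) (by linarith) (by linarith [hu.1])
    rw [Real.sinh_neg] at h1
    have h2 : u ≤ μ * Real.sinh u / Real.sinh μ := by
      rw [le_div_iff₀ hs]; linarith
    linarith [hnn hμ.le]
  -- tangent inequality for `sinh` at the point `v`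
  · obtain ⟨v, hv, hvt⟩ : ∃ v ∈ Set.Icc 0 μ, Real.cosh v = Real.sinh μ / μ := by
      have hmem : Real.sinh μ / μ ∈ Set.Icc (Real.cosh 0) (Real.cosh μ) := by
        constructor
        · rw [Real.cosh_zero, le_div_iff₀ hμ]
          linarith [Real.self_le_sinh_iff.2 hμ.le]
        · have := sinh_tangent_le (le_refl 0) hμ.le
          rw [Real.sinh_zero] at this
          rw [div_le_iff₀ hμ]
          linarith
      exact intermediate_value_Icc hμ.le Real.continuous_cosh.continuousOn hmem
    have hm := sub_sinh_div_cosh_monotoneOn hv.1 hμ.le hv.2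
    have ht := sinh_tangent_le h0 hv.1
    have hcp := Real.cosh_pos v
    have e : μ * Real.sinh u / Real.sinh μ = Real.sinh u / Real.cosh v := by
      rw [hvt]; field_simp
    have h3 : Real.sinh v / Real.cosh v + (u - v) ≤ Real.sinh u / Real.cosh v := by
      rw [le_div_iff₀ hcp, add_mul, div_mul_cancel₀ _ hcp.ne']
      linarith
    rw [e]
    simp only at hm
    linarith

/-- The right-hand side is the value of `u - tanh u` at `u = μ`. -/
lemma criticalCost_le {μ : ℝ} (hμ : 0 < μ) :
    criticalCost μ * μ ^ 2 ≤ μ - Real.sinh μ / Real.cosh μ := by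
  rw [← le_div_iff₀ (by positivity)]
  refine csSup_le ((Set.nonempty_Icc.2 zero_le_one).image _) ?_
  rintro _ ⟨x, hx, rfl⟩
  rw [le_div_iff₀ (by positivity), mul_comm, meanExit_sub_meanExit_neg hμ]
  exact sub_sinh_le hμ ⟨by nlinarith [hx.2], by nlinarith [hx.1]⟩

lemma criticalPoint_lt_half {μ : ℝ} (hμ : 0 < μ) : criticalPoint μ < 1 / 2 := by
  have ht : 1 < Real.sinh μ / μ := by
    rw [lt_div_iff₀ hμ]; linarith [Real.self_lt_sinh_iff.2 hμ]
  have e : μ ^ 2 / Real.sinh μ ^ 2 = ((Real.sinh μ / μ)⁻¹) ^ 2 := by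
    rw [inv_div, div_pow]
  rw [criticalPoint, e]
  generalize Real.sinh μ / μ = t at ht
  have hi0 : 0 < t⁻¹ := by positivity
  have hi1 : t⁻¹ < 1 := inv_lt_one_of_one_lt₀ ht
  have h1 : 1 - t⁻¹ < √(1 - t⁻¹ ^ 2) := by
    apply Real.lt_sqrt_of_sq_lt
    nlinarith
  have h2 : √(1 - t⁻¹ ^ 2) < 1 := by
    rw [Real.sqrt_lt' one_pos]
    nlinarith
  have h3 : Real.log (t * (1 - √(1 - t⁻¹ ^ 2))) < 0 := by
    refine Real.log_neg (mul_pos (by linarith) (by linarith)) ?_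
    calc t * (1 - √(1 - t⁻¹ ^ 2)) < t * t⁻¹ := by
          apply mul_lt_mul_of_pos_left _ (by linarith)
          linarith
      _ = 1 := mul_inv_cancel₀ (by linarith)
  rw [one_div, inv_mul_lt_iff₀ (by positivity)]
  linarith

/-- With `u = μ - 2μx`, the equation that defines `b_c` reads `u - tanh u = c μ²`; it has a
solution because the left-hand side vanishes at `0` and is at least `c* μ²` at `μ`. -/
lemma barrierB_lt_half {μ c : ℝ} (hμ : 0 < μ) (hc : 0 < c) (hcle : c ≤ criticalCost μ) :
    barrierB μ c < 1 / 2 := by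
  rw [barrierB]
  split_ifs with h
  · exact criticalPoint_lt_half hμ
  have hK : c * μ ^ 2 ≤ μ - Real.sinh μ / Real.cosh μ :=
    (mul_le_mul_of_nonneg_right hcle (by positivity)).trans (criticalCost_le hμ)
  obtain ⟨u, hu, hue⟩ : ∃ u ∈ Set.Icc 0 μ, u - Real.sinh u / Real.cosh u = c * μ ^ 2 := by
    refine intermediate_value_Icc hμ.le (Continuous.continuousOn ?_) ⟨?_, hK⟩
    · exact continuous_id.sub (Real.continuous_sinh.div Real.continuous_cosh
        fun u => (Real.cosh_pos u).ne')
    · simp only [Real.sinh_zero, zero_div, sub_zero]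
      positivity
  have hu0 : 0 < u := by
    rcases hu.1.eq_or_lt with rfl | h0
    · simp only [Real.sinh_zero, zero_div, sub_zero] at hue
      exact absurd hue (by positivity)
    · exact h0
  refine (Classical.epsilon_spec (p := fun x : ℝ => x ∈ Set.Ico (0 : ℝ) (1 / 2) ∧
    Real.exp (4 * μ * x - 2 * μ) * (2 * μ * x - μ + c * μ ^ 2 - 1)
      + 2 * μ * x - μ + c * μ ^ 2 + 1 = 0) ⟨(μ - u) / (2 * μ), ⟨?_, ?_⟩, ?_⟩).1.2
  · exact div_nonneg (by linarith [hu.2]) (by positivity)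
  · rw [div_lt_div_iff₀ (by positivity) two_pos]
    linarith
  · have e1 : 4 * μ * ((μ - u) / (2 * μ)) - 2 * μ = -u - u := by field_simp; ring
    have e2 : 2 * μ * ((μ - u) / (2 * μ)) = μ - u := by field_simp
    have hE : 0 < Real.exp u := Real.exp_pos u
    rw [e1, e2, ← hue, Real.sinh_eq, Real.cosh_eq, Real.exp_sub, Real.exp_neg]
    field_simp
    ring

/-! ### Switching times along a continuous path -/

lemma toNNReal_sInf_mem {S : Set ℝ≥0} (hS : IsClosed S)
    (h : sInf ((fun t : ℝ≥0 => (t : ℝ≥0∞)) '' S) ≠ ∞) :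
    (sInf ((fun t : ℝ≥0 => (t : ℝ≥0∞)) '' S)).toNNReal ∈ S := by
  rcases S.eq_empty_or_nonempty with rfl | hne
  · simp at h
  · rw [sInf_image, ← ENNReal.coe_sInf hne, ENNReal.toNNReal_coe]
    exact hS.csInf_mem hne (OrderBot.bddBelow S)

lemma isClosed_switchRegion (lo hi d : ℝ) : IsClosed (switchRegion lo hi d) := by
  unfold switchRegion
  split_ifs <;> exact isClosed_Icc

section Path

variable {lo hi μ x a : ℝ} {w : ℝ≥0 → ℝ}

lemma continuous_stage (hw : Continuous w) (n : ℕ) : Continuous (stage lo hi μ x a w n).2 := by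
  cases n <;> simp only [stage] <;> fun_prop

lemma switchTime_zero : switchTime lo hi μ x a w 0 = 0 := rfl

lemma switchTime_le_succ (n : ℕ) :
    switchTime lo hi μ x a w n ≤ switchTime lo hi μ x a w (n + 1) := by
  simp only [switchTime, stage]
  refine le_sInf ?_
  rintro _ ⟨t, ht, rfl⟩
  exact ht.1

lemma switchTime_mono : Monotone (switchTime lo hi μ x a w) :=
  monotone_nat_of_le_succ switchTime_le_succ

lemma stage_mem_switchRegion (hw : Continuous w) {n : ℕ}
    (h : switchTime lo hi μ x a w (n + 1) ≠ ∞) :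
    (stage lo hi μ x a w n).2 (switchTime lo hi μ x a w (n + 1)).toNNReal ∈
      switchRegion lo hi ((-1) ^ n * a) := by
  have hcl : IsClosed {t : ℝ≥0 | (stage lo hi μ x a w n).1 ≤ (t : ℝ≥0∞) ∧
      (stage lo hi μ x a w n).2 t ∈ switchRegion lo hi ((-1) ^ n * a)} :=
    (isClosed_le continuous_const ENNReal.continuous_coe).inter
      ((isClosed_switchRegion _ _ _).preimage (continuous_stage hw n))
  exact (toNNReal_sInf_mem hcl h).2

/-- From the time `τ n` on, the `n`-th auxiliary path continues its value at `τ n` with constant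
drift. -/
lemma stage_eq (n : ℕ) (t : ℝ≥0) :
    (stage lo hi μ x a w n).2 t =
      (stage lo hi μ x a w n).2 (switchTime lo hi μ x a w n).toNNReal
        + (-1) ^ n * a * μ * ((t : ℝ) - ((switchTime lo hi μ x a w n).toNNReal : ℝ))
        + (w t - w (switchTime lo hi μ x a w n).toNNReal) := by
  cases n with
  | zero => simp [switchTime, stage]
  | succ n => simp [switchTime, stage]

lemma stage_succ_apply_switchTime (n : ℕ) :
    (stage lo hi μ x a w (n + 1)).2 (switchTime lo hi μ x a w (n + 1)).toNNReal =
      (stage lo hi μ x a w n).2 (switchTime lo hi μ x a w (n + 1)).toNNReal := by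
  simp [switchTime, stage]

/-- The two switching regions lie at distance at least `δ` from each other. -/
def RegionGap (lo hi δ : ℝ) : Prop :=
  ∀ p ∈ switchRegion lo hi 1, ∀ q ∈ switchRegion lo hi (-1), δ ≤ |p - q|

lemma exists_regionGap (h : hi < 1 / 2 ∨ 1 / 2 < lo) : ∃ δ > 0, RegionGap lo hi δ := by
  have h1 : (-1 : ℝ) ≠ 1 := by norm_num
  rcases h with h | h
  · refine ⟨1 - 2 * hi, by linarith, fun p hp q hq => ?_⟩
    simp only [switchRegion, if_true, if_neg h1, Set.mem_Icc] at hp hq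
    exact le_abs.2 (Or.inr (by linarith))
  · refine ⟨2 * lo - 1, by linarith, fun p hp q hq => ?_⟩
    simp only [switchRegion, if_true, if_neg h1, Set.mem_Icc] at hp hq
    exact le_abs.2 (Or.inl (by linarith))

lemma neg_one_pow_mul_eq (ha : a = -1 ∨ a = 1) (n : ℕ) :
    (-1 : ℝ) ^ n * a = -1 ∨ (-1 : ℝ) ^ n * a = 1 := by
  rcases neg_one_pow_eq_or ℝ n with h | h <;> rcases ha with rfl | rfl <;> simp [h]

/-- Between two consecutive switches the particle crosses from one region to the other, so that
drift and driving path together move it by at least `δ`. -/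
lemma le_abs_sub_switchTime {δ : ℝ} (hg : RegionGap lo hi δ) (hμ : 0 < μ) (ha : a = -1 ∨ a = 1)
    (hw : Continuous w) {n : ℕ} (h : switchTime lo hi μ x a w (n + 2) ≠ ∞) :
    δ ≤ μ * (((switchTime lo hi μ x a w (n + 2)).toNNReal : ℝ)
          - ((switchTime lo hi μ x a w (n + 1)).toNNReal : ℝ))
      + |w (switchTime lo hi μ x a w (n + 2)).toNNReal
          - w (switchTime lo hi μ x a w (n + 1)).toNNReal| := by
  have hle := switchTime_le_succ (lo := lo) (hi := hi) (μ := μ) (x := x) (a := a) (w := w) (n + 1)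
  have h1 : switchTime lo hi μ x a w (n + 1) ≠ ∞ := ne_top_of_le_ne_top h hle
  have m1 := stage_mem_switchRegion hw h1
  have m2 := stage_mem_switchRegion hw h
  rw [stage_eq, stage_succ_apply_switchTime] at m2
  have hle' : ((switchTime lo hi μ x a w (n + 1)).toNNReal : ℝ) ≤
      ((switchTime lo hi μ x a w (n + 2)).toNNReal : ℝ) :=
    NNReal.coe_le_coe.2 (ENNReal.toNNReal_mono h hle)
  have hs : (-1 : ℝ) ^ (n + 1) * a = -((-1 : ℝ) ^ n * a) := by ring
  rw [hs] at m2
  generalize (stage lo hi μ x a w n).2 (switchTime lo hi μ x a w (n + 1)).toNNReal = p at *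
  generalize (switchTime lo hi μ x a w (n + 1)).toNNReal = s at *
  generalize (switchTime lo hi μ x a w (n + 2)).toNNReal = t at *
  have key : ∀ v : ℝ, |v| = 1 → δ ≤ |v * μ * ((t : ℝ) - s) + (w t - w s)| →
      δ ≤ μ * ((t : ℝ) - s) + |w t - w s| := by
    intro v hv hδ
    refine hδ.trans ((abs_add_le _ _).trans (le_of_eq ?_))
    rw [abs_mul, abs_mul, hv, abs_of_pos hμ, abs_of_nonneg (sub_nonneg.2 hle'), one_mul]
  rcases neg_one_pow_mul_eq ha n with hv | hv <;> rw [hv] at m1 m2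
  · rw [neg_neg] at m2
    refine key 1 abs_one ((hg _ m2 _ m1).trans (le_of_eq ?_))
    congr 1; ring
  · refine key (-1) (by simp) ((hg _ m1 _ m2).trans (le_of_eq ?_))
    rw [abs_sub_comm]
    congr 1; ring

/-- On a compact time interval, consecutive switching times are uniformly separated. -/
lemma exists_add_le_switchTime {δ : ℝ} (hδ : 0 < δ) (hg : RegionGap lo hi δ) (hμ : 0 < μ)
    (ha : a = -1 ∨ a = 1) (hw : Continuous w) (T : ℝ≥0) :
    ∃ ε : ℝ≥0, 0 < ε ∧ ∀ n, switchTime lo hi μ x a w (n + 2) ≤ T →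
      switchTime lo hi μ x a w (n + 1) + ε ≤ switchTime lo hi μ x a w (n + 2) := by
  have huc : UniformContinuousOn w (Set.Icc 0 T) :=
    isCompact_Icc.uniformContinuousOn_of_continuous hw.continuousOn
  obtain ⟨ε₁, hε₁, H⟩ := Metric.uniformContinuousOn_iff.1 huc (δ / 2) (by positivity)
  have hε₀ : 0 < min ε₁ (δ / (2 * μ)) := lt_min hε₁ (by positivity)
  obtain ⟨ε, hε⟩ : ∃ ε : ℝ≥0, (ε : ℝ) = min ε₁ (δ / (2 * μ)) :=
    ⟨_, Real.coe_toNNReal _ hε₀.le⟩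
  refine ⟨ε, by rw [← NNReal.coe_pos, hε]; exact hε₀, fun n hn => ?_⟩
  have h2 : switchTime lo hi μ x a w (n + 2) ≠ ∞ := ne_top_of_le_ne_top ENNReal.coe_ne_top hn
  have hle := switchTime_le_succ (lo := lo) (hi := hi) (μ := μ) (x := x) (a := a) (w := w) (n + 1)
  have h1 : switchTime lo hi μ x a w (n + 1) ≠ ∞ := ne_top_of_le_ne_top h2 hle
  have hmove := le_abs_sub_switchTime hg hμ ha hw h2
  rw [← ENNReal.coe_toNNReal h2] at hn hle ⊢
  rw [← ENNReal.coe_toNNReal h1] at hle ⊢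
  generalize (switchTime lo hi μ x a w (n + 1)).toNNReal = s at *
  generalize (switchTime lo hi μ x a w (n + 2)).toNNReal = t at *
  norm_cast at hn hle ⊢
  have hle' : (s : ℝ) ≤ t := hle
  rw [← NNReal.coe_le_coe, NNReal.coe_add, hε]
  by_contra! hlt
  have hd : (t : ℝ) - s < min ε₁ (δ / (2 * μ)) := by linarith
  obtain ⟨hd1, hd2⟩ := lt_min_iff.1 hd
  have hw' := H t ⟨zero_le, hn⟩ s ⟨zero_le, hle.trans hn⟩
    (by rw [NNReal.dist_eq, abs_of_nonneg (sub_nonneg.2 hle')]; exact hd1)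
  rw [Real.dist_eq] at hw'
  have : μ * ((t : ℝ) - s) < δ / 2 := by
    rw [lt_div_iff₀ (by positivity)] at hd2
    linarith
  linarith

lemma switchTime_lt_succ {δ : ℝ} (hδ : 0 < δ) (hg : RegionGap lo hi δ) (hμ : 0 < μ)
    (ha : a = -1 ∨ a = 1) (hw : Continuous w) {n : ℕ}
    (h : switchTime lo hi μ x a w (n + 1) ≠ ∞) :
    switchTime lo hi μ x a w (n + 1) < switchTime lo hi μ x a w (n + 2) := by
  rcases eq_or_ne (switchTime lo hi μ x a w (n + 2)) ∞ with h2 | h2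
  · rw [h2]; exact h.lt_top
  · obtain ⟨ε, hε, H⟩ := exists_add_le_switchTime (x := x) hδ hg hμ ha hw
      (switchTime lo hi μ x a w (n + 2)).toNNReal
    refine lt_of_lt_of_le (ENNReal.lt_add_right h (by exact_mod_cast hε.ne')) (H n ?_)
    rw [ENNReal.coe_toNNReal h2]

/-- Switching times do not accumulate. -/
lemma exists_lt_switchTime {δ : ℝ} (hδ : 0 < δ) (hg : RegionGap lo hi δ) (hμ : 0 < μ)
    (ha : a = -1 ∨ a = 1) (hw : Continuous w) (T : ℝ≥0) :
    ∃ n, (T : ℝ≥0∞) < switchTime lo hi μ x a w n := by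
  obtain ⟨ε, hε, H⟩ := exists_add_le_switchTime (x := x) hδ hg hμ ha hw T
  by_contra! hT
  have hn (n : ℕ) : ((n * ε : ℝ≥0) : ℝ≥0∞) ≤ switchTime lo hi μ x a w (n + 1) := by
    induction n with
    | zero => simp
    | succ n ih =>
      refine le_trans ?_ (H n (hT _))
      push_cast at ih ⊢
      rw [add_mul, one_mul]
      gcongr
  obtain ⟨n, hn'⟩ := exists_nat_gt (T / ε)
  have := (hn n).trans (hT _)
  rw [ENNReal.coe_le_coe] at this
  rw [div_lt_iff₀ hε] at hn'
  exact absurd this (not_le.2 hn')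

lemma exists_switchTime_le_lt {δ : ℝ} (hδ : 0 < δ) (hg : RegionGap lo hi δ) (hμ : 0 < μ)
    (ha : a = -1 ∨ a = 1) (hw : Continuous w) (t : ℝ≥0) :
    ∃ n, switchTime lo hi μ x a w n ≤ t ∧ t < switchTime lo hi μ x a w (n + 1) := by
  classical
  have hex := exists_lt_switchTime (x := x) hδ hg hμ ha hw t
  have h0 : Nat.find hex ≠ 0 := by
    intro h
    have := Nat.find_spec hex
    rw [h, switchTime_zero] at this
    exact not_lt_zero this
  obtain ⟨n, hn⟩ := Nat.exists_eq_succ_of_ne_zero h0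
  exact ⟨n, not_lt.1 (Nat.find_min hex (by omega)), by
    have := Nat.find_spec hex
    rwa [hn] at this⟩

lemma setOf_switchTime_le {n : ℕ} {t : ℝ≥0} (h1 : switchTime lo hi μ x a w n ≤ t)
    (h2 : t < switchTime lo hi μ x a w (n + 1)) :
    {k : ℕ | switchTime lo hi μ x a w k ≤ (t : ℝ≥0∞)} = Set.Iic n := by
  ext k
  refine ⟨fun hk => ?_, fun hk => (switchTime_mono hk).trans h1⟩
  by_contra hkn
  exact absurd (hk.trans_lt h2) (not_lt.2 (switchTime_mono (by simpa using hkn)))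

lemma thresholdStrategy_eq {n : ℕ} {t : ℝ≥0} (h1 : switchTime lo hi μ x a w n ≤ t)
    (h2 : t < switchTime lo hi μ x a w (n + 1)) :
    thresholdStrategy lo hi μ x a w t = (-1) ^ n * a := by
  rw [thresholdStrategy, setOf_switchTime_le h1 h2, csSup_Iic]

lemma abs_thresholdStrategy (ha : a = -1 ∨ a = 1) (t : ℝ≥0) :
    |thresholdStrategy lo hi μ x a w t| = 1 := by
  rcases neg_one_pow_mul_eq ha (sSup {n : ℕ | switchTime lo hi μ x a w n ≤ (t : ℝ≥0∞)})
    with h | h <;> rw [thresholdStrategy, h] <;> simp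

lemma leftLim_thresholdStrategy {n : ℕ} {t : ℝ≥0} (h1 : switchTime lo hi μ x a w n < t)
    (h2 : t ≤ switchTime lo hi μ x a w (n + 1)) :
    Function.leftLim (thresholdStrategy lo hi μ x a w) t = (-1) ^ n * a := by
  have ht : 0 < t := by exact_mod_cast zero_le.trans_lt h1
  have : (nhdsWithin t (Set.Iio t)).NeBot := nhdsLT_neBot_of_exists_lt ⟨0, ht⟩
  refine leftLim_eq_of_tendsto (tendsto_const_nhds.congr' ?_)
  have hev : ∀ᶠ s : ℝ≥0 in nhds t, switchTime lo hi μ x a w n < s :=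
    ENNReal.continuous_coe.continuousAt.eventually (lt_mem_nhds h1)
  filter_upwards [nhdsWithin_le_nhds hev, self_mem_nhdsWithin] with s hs1 hs2
  exact (thresholdStrategy_eq hs1.le (lt_of_lt_of_le (by exact_mod_cast hs2) h2)).symm

/-- The switches of the strategy occur exactly at the finite switching times `τ n`, `n ≥ 1`. -/
lemma numSwitches_thresholdStrategy {δ : ℝ} (hδ : 0 < δ) (hg : RegionGap lo hi δ) (hμ : 0 < μ)
    (ha : a = -1 ∨ a = 1) (hw : Continuous w) (T : ℝ≥0∞) :
    numSwitches a (thresholdStrategy lo hi μ x a w) T =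
      {n : ℕ | switchTime lo hi μ x a w (n + 1) ≤ T ∧
        switchTime lo hi μ x a w (n + 1) ≠ ∞}.encard := by
  have ha0 : a ≠ 0 := by rcases ha with rfl | rfl <;> norm_num
  have hflip (n : ℕ) : (-1 : ℝ) ^ n * a ≠ (-1) ^ (n + 1) * a := by
    rcases neg_one_pow_mul_eq ha n with h | h <;> rw [pow_succ] <;> intro h' <;> linarith
  set A := {n : ℕ | switchTime lo hi μ x a w (n + 1) ≤ T ∧
        switchTime lo hi μ x a w (n + 1) ≠ ∞} with hA
  have hinj : Set.InjOn (fun n => (switchTime lo hi μ x a w (n + 1)).toNNReal) A := by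
    have key : ∀ m ∈ A, ∀ n ∈ A, m < n → (switchTime lo hi μ x a w (m + 1)).toNNReal ≠
        (switchTime lo hi μ x a w (n + 1)).toNNReal := by
      intro m hm n hn hmn heq
      rw [ENNReal.toNNReal_eq_toNNReal_iff' hm.2 hn.2] at heq
      have := (switchTime_lt_succ hδ hg hμ ha hw hm.2).trans_le
        (switchTime_mono (lo := lo) (hi := hi) (μ := μ) (x := x) (a := a) (w := w)
          (show m + 2 ≤ n + 1 by omega))
      exact this.ne heq
    intro m hm n hn heq
    rcases lt_trichotomy m n with h | h | h
    · exact absurd heq (key m hm n hn h)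
    · exact h
    · exact absurd heq.symm (key n hn m hm h)
  rw [numSwitches, ← hinj.encard_image]
  congr 1
  ext s
  simp only [Set.mem_ofPred_eq, Set.mem_image]
  obtain ⟨n, hn1, hn2⟩ := exists_switchTime_le_lt (x := x) hδ hg hμ ha hw s
  have hval := thresholdStrategy_eq hn1 hn2
  constructor
  · rintro ⟨hsT, hne⟩
    rw [hval] at hne
    rcases n with _ | n
    · exfalso
      apply hne
      unfold valueBefore
      split_ifs with h0
      · simp
      · refine leftLim_thresholdStrategy ?_ hn2.le
        rw [switchTime_zero]
        exact_mod_cast pos_iff_ne_zero.2 h0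
    · have heq : switchTime lo hi μ x a w (n + 1) = s := by
        refine hn1.antisymm (not_lt.1 fun hlt => hne ?_)
        have hs0 : s ≠ 0 := by
          rintro rfl
          exact not_lt_zero hlt
        rw [valueBefore, if_neg hs0]
        exact leftLim_thresholdStrategy hlt hn2.le
      exact ⟨n, ⟨heq ▸ hsT, heq ▸ ENNReal.coe_ne_top⟩, by rw [heq, ENNReal.toNNReal_coe]⟩
  · rintro ⟨m, ⟨hmT, hm⟩, rfl⟩
    have hlt := switchTime_lt_succ hδ hg hμ ha hw hm
    have hco := ENNReal.coe_toNNReal hm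
    refine ⟨hco ▸ hmT, ?_⟩
    rw [thresholdStrategy_eq (n := m + 1) hco.ge (hco ▸ hlt), valueBefore]
    split_ifs with h0
    · have hm0 : m = 0 := by
        by_contra hm0
        obtain ⟨k, rfl⟩ := Nat.exists_eq_succ_of_ne_zero hm0
        have h0' : switchTime lo hi μ x a w (k + 1 + 1) = 0 := by
          rw [← hco]; exact_mod_cast h0
        have hk : switchTime lo hi μ x a w (k + 1) < switchTime lo hi μ x a w (k + 2) :=
          switchTime_lt_succ hδ hg hμ ha hw (ne_top_of_le_ne_top hm (switchTime_le_succ _))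
        rw [h0'] at hk
        exact not_lt_zero hk
      subst hm0
      simpa using hflip 0
    · rw [leftLim_thresholdStrategy (n := m) ?_ hco.le]
      · exact hflip m
      · rw [hco]
        rcases m with _ | m
        · rw [switchTime_zero, ← hco]
          exact_mod_cast pos_iff_ne_zero.2 h0
        · exact switchTime_lt_succ hδ hg hμ ha hw
            (ne_top_of_le_ne_top hm (switchTime_le_succ _))

end Path

/-! ### Counting oscillations of a path on a grid -/

/-- Greedy count of the oscillations of size `θ` of the path `w` along the grid `0, h, 2h, …`.
The second component after `n` steps is the number of resets so far, the first one is the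
displacement of `w` since the last reset; a reset takes place as soon as this displacement is at
least `θ` in absolute value. -/
noncomputable def greedy (θ : ℝ) (w : ℝ≥0 → ℝ) (h : ℝ≥0) : ℕ → ℝ × ℕ
  | 0 => (0, 0)
  | n + 1 =>
    if |(greedy θ w h n).1 + (w (n * h + h) - w (n * h))| < θ then
      ((greedy θ w h n).1 + (w (n * h + h) - w (n * h)), (greedy θ w h n).2)
    else (0, (greedy θ w h n).2 + 1)

section Greedy

variable {θ : ℝ} {w w' : ℝ≥0 → ℝ} {h : ℝ≥0}

lemma abs_greedy_fst_lt (hθ : 0 < θ) (n : ℕ) : |(greedy θ w h n).1| < θ := by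
  cases n with
  | zero => simpa [greedy] using hθ
  | succ n =>
    rw [greedy]
    split_ifs with h1
    · exact h1
    · simpa using hθ

lemma greedy_snd_mono : Monotone fun n => (greedy θ w h n).2 := by
  refine monotone_nat_of_le_succ fun n => ?_
  rw [greedy]
  split_ifs <;> simp

lemma greedy_snd_le (n : ℕ) : (greedy θ w h n).2 ≤ n := by
  induction n with
  | zero => simp [greedy]
  | succ n ih =>
    rw [greedy]
    split_ifs
    · exact ih.trans n.le_succ
    · exact Nat.succ_le_succ ih

lemma greedy_congr (n : ℕ) (hw : ∀ k ≤ n, w (k * h) = w' (k * h)) :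
    greedy θ w h n = greedy θ w' h n := by
  induction n with
  | zero => rfl
  | succ n ih =>
    have h1 := hw (n + 1) le_rfl
    push_cast at h1
    rw [add_mul, one_mul] at h1
    simp only [greedy, ih fun k hk => hw k (hk.trans n.le_succ), h1, hw n n.le_succ]

/-- Every reset pays for itself: the potential `θ² · count + displacement²` grows by at most what
the squared displacement would have gained without the reset. -/
lemma greedy_potential_succ (hθ : 0 < θ) (n : ℕ) :
    θ ^ 2 * (greedy θ w h (n + 1)).2 + (greedy θ w h (n + 1)).1 ^ 2 ≤
      θ ^ 2 * (greedy θ w h n).2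
        + ((greedy θ w h n).1 + (w (n * h + h) - w (n * h))) ^ 2 := by
  rw [greedy]
  split_ifs with h1
  · exact le_rfl
  · have : θ ^ 2 ≤ ((greedy θ w h n).1 + (w (n * h + h) - w (n * h))) ^ 2 := by
      rw [← sq_abs ((greedy θ w h n).1 + _)]
      exact pow_le_pow_left₀ hθ.le (not_lt.1 h1) 2
    push_cast
    linarith

lemma greedy_fst_sub {i j : ℕ} (hij : i ≤ j) (hc : (greedy θ w h j).2 = (greedy θ w h i).2) :
    (greedy θ w h j).1 - (greedy θ w h i).1 = w (j * h) - w (i * h) := by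
  induction j, hij using Nat.le_induction with
  | base => simp
  | succ j hij ih =>
    have hm := greedy_snd_mono (θ := θ) (w := w) (h := h) hij
    have e : ((j + 1 : ℕ) : ℝ≥0) * h = j * h + h := by push_cast; ring
    rw [e]
    rw [greedy] at hc ⊢
    split_ifs with h1
    · rw [if_pos h1] at hc
      have := ih hc
      simp only at this ⊢
      linarith
    · rw [if_neg h1] at hc
      simp only at hm hc
      omega

lemma greedy_snd_lt (hθ : 0 < θ) {i j : ℕ} (hij : i ≤ j)
    (hw : 2 * θ ≤ |w (j * h) - w (i * h)|) : (greedy θ w h i).2 < (greedy θ w h j).2 := by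
  refine lt_of_le_of_ne (greedy_snd_mono hij) fun hc => ?_
  rw [← greedy_fst_sub hij hc.symm] at hw
  have h1 := abs_greedy_fst_lt (w := w) (h := h) hθ i
  have h2 := abs_greedy_fst_lt (w := w) (h := h) hθ j
  have h3 := abs_sub (greedy θ w h j).1 (greedy θ w h i).1
  linarith

lemma measurable_greedy (n : ℕ) : Measurable fun w : ℝ≥0 → ℝ => greedy θ w h n := by
  induction n with
  | zero => exact measurable_const
  | succ n ih =>
    have hy : Measurable fun w : ℝ≥0 → ℝ =>
        (greedy θ w h n).1 + (w (n * h + h) - w (n * h)) := by fun_prop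
    simp only [greedy]
    refine Measurable.ite (measurableSet_lt hy.abs measurable_const) ?_ ?_ <;> fun_prop

end Greedy

/-- The number of oscillations of size `θ` of the path `w` on `[0, η]`, as seen by the greedy count
along finer and finer grids. -/
noncomputable def oscillations (θ : ℝ) (η : ℝ≥0) (w : ℝ≥0 → ℝ) : ℝ≥0∞ :=
  Filter.liminf (fun L : ℕ => ((greedy θ w (η / (L + 1 : ℕ)) (L + 1)).2 : ℝ≥0∞)) Filter.atTop

lemma measurable_oscillations (θ : ℝ) (η : ℝ≥0) : Measurable (oscillations θ η) :=
  Measurable.liminf fun L =>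
    (measurable_from_top (f := fun n : ℕ => (n : ℝ≥0∞))).comp (measurable_greedy (L + 1)).snd

/-- Successive moves of size at least `4θ` within `[0, η]` are all noticed on a fine grid. -/
lemma le_oscillations {θ : ℝ} (hθ : 0 < θ) {η : ℝ≥0} (hη : 0 < η) {w : ℝ≥0 → ℝ}
    (hw : Continuous w) (m : ℕ) (s : ℕ → ℝ≥0) (hs : ∀ i < m, s i ≤ s (i + 1))
    (hsη : ∀ i ≤ m, s i ≤ η) (hmove : ∀ i < m, 4 * θ ≤ |w (s (i + 1)) - w (s i)|) :
    (m : ℝ≥0∞) ≤ oscillations θ η w := by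
  have huc : UniformContinuousOn w (Set.Icc 0 η) :=
    isCompact_Icc.uniformContinuousOn_of_continuous hw.continuousOn
  obtain ⟨ε, hε, H⟩ := Metric.uniformContinuousOn_iff.1 huc θ hθ
  have hev : ∀ᶠ L : ℕ in Filter.atTop, ((η / (L + 1 : ℕ) : ℝ≥0) : ℝ) < ε := by
    have ht := (tendsto_const_div_atTop_nhds_zero_nat (η : ℝ)).comp (Filter.tendsto_add_atTop_nat 1)
    filter_upwards [ht.eventually (gt_mem_nhds hε)] with L hL
    simpa using hL
  refine Filter.le_liminf_of_le (by isBoundedDefault) ?_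
  filter_upwards [hev] with L hL
  have hN : (0 : ℝ≥0) < (L + 1 : ℕ) := by exact_mod_cast L.succ_pos
  have hNη : ((L + 1 : ℕ) : ℝ≥0) * (η / (L + 1 : ℕ)) = η := mul_div_cancel₀ _ hN.ne'
  have hh : 0 < η / (L + 1 : ℕ) := div_pos hη hN
  generalize η / (L + 1 : ℕ) = h at *
  generalize L + 1 = N at *
  -- the last grid point before the time `s i`
  set g : ℕ → ℕ := fun i => ⌊s i / h⌋₊ with hg
  have hg1 (i : ℕ) : (g i : ℝ≥0) * h ≤ s i := by
    rw [← le_div_iff₀ hh]; exact Nat.floor_le zero_le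
  have hg2 (i : ℕ) : s i < (g i + 1) * h := by
    rw [← div_lt_iff₀ hh]; exact Nat.lt_floor_add_one _
  have hclose (i : ℕ) (hi : i ≤ m) : |w (s i) - w (g i * h)| < θ := by
    refine H _ ⟨zero_le, hsη i hi⟩ _ ⟨zero_le, (hg1 i).trans (hsη i hi)⟩ ?_
    have h1 : ((g i * h : ℝ≥0) : ℝ) ≤ s i := hg1 i
    have h2 : (s i : ℝ) < ((g i + 1) * h : ℝ≥0) := hg2 i
    rw [NNReal.dist_eq, abs_of_nonneg (sub_nonneg.2 h1)]
    push_cast at h1 h2 ⊢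
    linarith
  have hcount : ∀ i ≤ m, i ≤ (greedy θ w h (g i)).2 := by
    intro i
    induction i with
    | zero => exact fun _ => Nat.zero_le _
    | succ i ih =>
      intro hi
      have him : i < m := hi
      refine Nat.succ_le_of_lt ((ih him.le).trans_lt (greedy_snd_lt hθ ?_ ?_))
      · exact Nat.floor_mono (div_le_div_of_nonneg_right (hs i him) zero_le)
      · have h1 := abs_lt.1 (hclose i him.le)
        have h2 := abs_lt.1 (hclose (i + 1) hi)
        rcases le_abs.1 (hmove i him) with h3 | h3
        · exact le_abs.2 (Or.inl (by linarith [h1.1, h1.2, h2.1, h2.2]))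
        · exact le_abs.2 (Or.inr (by linarith [h1.1, h1.2, h2.1, h2.2]))
  have hlast : g m ≤ N := by
    have : s m / h ≤ N := by
      rw [div_le_iff₀ hh, hNη]; exact hsη m le_rfl
    exact Nat.floor_le_of_le this
  exact_mod_cast (hcount m le_rfl).trans (greedy_snd_mono hlast)

section Brownian

variable {Ω : Type*} [MeasurableSpace Ω] {P : Measure Ω} {B : ℝ≥0 → Ω → ℝ}

lemma integral_increment_sq (hB : IsBrownianReal B P) (t h : ℝ≥0) :
    ∫ ω, (B (t + h) ω - B t ω) ^ 2 ∂P = h := by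
  have hl := (hB.shift t).hasLaw_eval h
  have hm := (hB.shift t).integral_eval h
  have hv := hl.variance_eq
  rw [variance_of_integral_eq_zero hl.aemeasurable hm, variance_id_gaussianReal] at hv
  exact hv

/-- The potential `θ² · count + displacement²` grows by at most `h` in mean at each step, because
the next increment is centered and independent of the past. -/
lemma integral_greedy_le (hB : IsBrownianReal B P) (hBm : ∀ t, Measurable (B t)) {θ : ℝ}
    (hθ : 0 < θ) (h : ℝ≥0) (n : ℕ) :
    ∫ ω, (θ ^ 2 * ((greedy θ (B · ω) h n).2 : ℝ) + (greedy θ (B · ω) h n).1 ^ 2) ∂P ≤ n * h := by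
  have : IsProbabilityMeasure P := hB.isGaussianProcess.isProbabilityMeasure
  have hpath : Measurable fun ω => (B · ω) := measurable_pi_lambda _ hBm
  have hDm (n : ℕ) : Measurable fun ω => (greedy θ (B · ω) h n).1 :=
    ((measurable_greedy n).comp hpath).fst
  have hCm (n : ℕ) : Measurable fun ω => ((greedy θ (B · ω) h n).2 : ℝ) :=
    (measurable_from_top (f := fun n : ℕ => (n : ℝ))).comp ((measurable_greedy n).comp hpath).snd
  have hD (n : ℕ) : MemLp (fun ω => (greedy θ (B · ω) h n).1) 2 P :=
    MemLp.of_bound (hDm n).aestronglyMeasurable θ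
      (ae_of_all _ fun ω => (abs_greedy_fst_lt hθ n).le)
  have hC (n : ℕ) : Integrable (fun ω => θ ^ 2 * ((greedy θ (B · ω) h n).2 : ℝ)) P := by
    refine (Integrable.of_bound (hCm n).aestronglyMeasurable (n : ℝ)
      (ae_of_all _ fun ω => ?_)).const_mul _
    rw [Real.norm_natCast]
    exact_mod_cast greedy_snd_le n
  induction n with
  | zero => simp [greedy]
  | succ n ih =>
    set t : ℝ≥0 := n * h with ht
    have hξ : MemLp (fun ω => B (t + h) ω - B t ω) 2 P :=
      ((hB.shift t).hasLaw_eval h).hasGaussianLaw.memLp_two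
    have hind : IndepFun (fun ω => (greedy θ (B · ω) h n).1)
        (fun ω => B (t + h) ω - B t ω) P := by
      -- the displacement as a function of the path up to time `t`, continued as a constant
      have hψ : Measurable fun v : Set.Iic t → ℝ =>
          (greedy θ (fun s => v ⟨min s t, Set.mem_Iic.2 (min_le_right s t)⟩) h n).1 :=
        ((measurable_greedy n).comp (measurable_pi_lambda _ fun s =>
          measurable_pi_apply (⟨min s t, Set.mem_Iic.2 (min_le_right s t)⟩ : Set.Iic t))).fst
      have := (hB.indepFun_shift t).symm.comp hψ (measurable_pi_apply h)
      convert this using 1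
      · ext ω
        simp only [Function.comp]
        rw [greedy_congr n fun k hk => ?_]
        have : (k : ℝ≥0) * h ≤ t := by
          rw [ht]; gcongr
        rw [min_eq_left this]
      · rfl
    have hcross : ∫ ω, (greedy θ (B · ω) h n).1 * (B (t + h) ω - B t ω) ∂P = 0 := by
      rw [hind.integral_fun_mul_eq_mul_integral (hD n).aestronglyMeasurable
        hξ.aestronglyMeasurable, (hB.shift t).integral_eval h, mul_zero]
    have hint : Integrable (fun ω => (greedy θ (B · ω) h n).1 * (B (t + h) ω - B t ω)) P :=
      (hD n).integrable_mul hξ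
    have hpot (n : ℕ) : Integrable (fun ω => θ ^ 2 * ((greedy θ (B · ω) h n).2 : ℝ)
        + (greedy θ (B · ω) h n).1 ^ 2) P := (hC n).add (hD n).integrable_sq
    have hpot' : Integrable (fun ω => (θ ^ 2 * ((greedy θ (B · ω) h n).2 : ℝ)
        + (greedy θ (B · ω) h n).1 ^ 2)
        + 2 * ((greedy θ (B · ω) h n).1 * (B (t + h) ω - B t ω))) P :=
      (hpot n).add (hint.const_mul 2)
    calc ∫ ω, (θ ^ 2 * ((greedy θ (B · ω) h (n + 1)).2 : ℝ) + (greedy θ (B · ω) h (n + 1)).1 ^ 2) ∂P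
        ≤ ∫ ω, ((θ ^ 2 * ((greedy θ (B · ω) h n).2 : ℝ) + (greedy θ (B · ω) h n).1 ^ 2)
            + 2 * ((greedy θ (B · ω) h n).1 * (B (t + h) ω - B t ω))
            + (B (t + h) ω - B t ω) ^ 2) ∂P := by
          refine integral_mono (hpot _) (hpot'.add hξ.integrable_sq) fun ω => ?_
          have := greedy_potential_succ (w := (B · ω)) (h := h) hθ n
          simp only at this ⊢
          linarith
      _ = ∫ ω, (θ ^ 2 * ((greedy θ (B · ω) h n).2 : ℝ) + (greedy θ (B · ω) h n).1 ^ 2) ∂P + h := by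
          rw [integral_add hpot' hξ.integrable_sq, integral_add (hpot n) (hint.const_mul 2),
            integral_const_mul, hcross, integral_increment_sq hB]
          ring
      _ ≤ (n + 1 : ℕ) * h := by
          push_cast
          linarith

/-- The expected number of oscillations of size `θ` on `[0, η]` is at most `η / θ²`. -/
lemma lintegral_oscillations_le (hB : IsBrownianReal B P) (hBm : ∀ t, Measurable (B t)) {θ : ℝ}
    (hθ : 0 < θ) (η : ℝ≥0) :
    ∫⁻ ω, oscillations θ η (B · ω) ∂P ≤ ENNReal.ofReal (η / θ ^ 2) := by
  have : IsProbabilityMeasure P := hB.isGaussianProcess.isProbabilityMeasure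
  have hpath : Measurable fun ω => (B · ω) := measurable_pi_lambda _ hBm
  have hCm (h : ℝ≥0) (n : ℕ) : Measurable fun ω => (greedy θ (B · ω) h n).2 :=
    ((measurable_greedy n).comp hpath).snd
  refine (lintegral_liminf_le fun L =>
    (measurable_from_top (f := fun n : ℕ => (n : ℝ≥0∞))).comp (hCm _ _)).trans ?_
  refine Filter.liminf_le_of_le (by isBoundedDefault) fun b hb => ?_
  obtain ⟨L, hL⟩ := hb.exists
  refine hL.trans ?_
  have hN : ((L + 1 : ℕ) : ℝ) ≠ 0 := by positivity
  have hNη : ((L + 1 : ℕ) : ℝ) * ((η / (L + 1 : ℕ) : ℝ≥0) : ℝ) = η := by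
    rw [NNReal.coe_div, NNReal.coe_natCast, mul_div_cancel₀ _ hN]
  have hle := integral_greedy_le hB hBm hθ (η / (L + 1 : ℕ)) (L + 1)
  rw [hNη] at hle
  generalize η / (L + 1 : ℕ) = h at *
  generalize L + 1 = n at *
  have hC : Integrable (fun ω => ((greedy θ (B · ω) h n).2 : ℝ)) P := by
    refine Integrable.of_bound
      ((measurable_from_top (f := fun n : ℕ => (n : ℝ))).comp (hCm h n)).aestronglyMeasurable
      (n : ℝ) (ae_of_all _ fun ω => ?_)
    rw [Real.norm_natCast]
    exact_mod_cast greedy_snd_le n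
  have hD : MemLp (fun ω => (greedy θ (B · ω) h n).1) 2 P :=
    MemLp.of_bound ((measurable_greedy n).comp hpath).fst.aestronglyMeasurable θ
      (ae_of_all _ fun ω => (abs_greedy_fst_lt hθ n).le)
  calc ∫⁻ ω, ((greedy θ (B · ω) h n).2 : ℝ≥0∞) ∂P
      = ∫⁻ ω, ENNReal.ofReal ((greedy θ (B · ω) h n).2 : ℝ) ∂P := by simp
    _ = ENNReal.ofReal (∫ ω, ((greedy θ (B · ω) h n).2 : ℝ) ∂P) :=
        (ofReal_integral_eq_lintegral_ofReal hC (ae_of_all _ fun ω => Nat.cast_nonneg _)).symm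
    _ ≤ ENNReal.ofReal (η / θ ^ 2) := by
        refine ENNReal.ofReal_le_ofReal ?_
        rw [le_div_iff₀ (by positivity), mul_comm, ← integral_const_mul]
        refine (integral_mono (hC.const_mul _) ((hC.const_mul _).add hD.integrable_sq)
          fun ω => ?_).trans hle
        simp only [Pi.add_apply]
        linarith [sq_nonneg (greedy θ (B · ω) h n).1]

end Brownian

/-! ### Measurability of hitting times and of the controlled process -/

section Hitting

variable {Ω : Type*} [MeasurableSpace Ω]

/-- By compactness, a nonnegative continuous process vanishes somewhere on `[0, s]` if and only if
it takes arbitrarily small values along a countable dense subset. -/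
lemma measurableSet_exists_eq_zero {Y : ℝ≥0 → Ω → ℝ} (hc : ∀ ω, Continuous (Y · ω))
    (hm : ∀ t, Measurable (Y t)) (h0 : ∀ t ω, 0 ≤ Y t ω) (s : ℝ≥0) :
    MeasurableSet {ω | ∃ t ≤ s, Y t ω = 0} := by
  have : Nonempty (Set.Iic s) := ⟨⟨s, Set.mem_Iic.2 le_rfl⟩⟩
  have heq : {ω | ∃ t ≤ s, Y t ω = 0} = ⋂ n : ℕ, ⋃ k : ℕ,
      {ω | Y (TopologicalSpace.denseSeq (Set.Iic s) k : ℝ≥0) ω < 1 / ((n : ℝ) + 1)} := by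
    ext ω
    simp only [Set.mem_iInter, Set.mem_iUnion, Set.mem_ofPred_eq]
    have hcs : Continuous fun t : Set.Iic s => Y (t : ℝ≥0) ω := (hc ω).comp continuous_subtype_val
    constructor
    · rintro ⟨t, hts, ht⟩ n
      have hopen : IsOpen {t : Set.Iic s | Y (t : ℝ≥0) ω < 1 / ((n : ℝ) + 1)} :=
        isOpen_lt hcs continuous_const
      have hne : {t : Set.Iic s | Y (t : ℝ≥0) ω < 1 / ((n : ℝ) + 1)}.Nonempty :=
        ⟨⟨t, hts⟩, by simp only [Set.mem_ofPred_eq, ht]; positivity⟩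
      obtain ⟨_, hu, k, rfl⟩ :=
        (TopologicalSpace.denseRange_denseSeq (Set.Iic s)).inter_open_nonempty _ hopen hne
      exact ⟨k, hu⟩
    · intro h
      have hcomp : IsCompact (Set.Iic s) := by
        rw [← Set.Icc_bot]; exact isCompact_Icc
      obtain ⟨t, hts, ht⟩ := hcomp.exists_isMinOn ⟨s, Set.mem_Iic.2 le_rfl⟩ (hc ω).continuousOn
      refine ⟨t, hts, le_antisymm (le_of_forall_pos_le_add fun ε hε => ?_) (h0 t ω)⟩
      obtain ⟨n, hn⟩ := exists_nat_one_div_lt hε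
      obtain ⟨k, hk⟩ := h n
      have := ht (TopologicalSpace.denseSeq (Set.Iic s) k).2
      simp only [Set.mem_ofPred_eq] at this
      linarith
  rw [heq]
  exact MeasurableSet.iInter fun n => MeasurableSet.iUnion fun k =>
    measurableSet_lt (hm _) measurable_const

lemma measurable_apply_toNNReal {X : ℝ≥0 → Ω → ℝ} (hc : ∀ ω, Continuous (X · ω))
    (hm : ∀ t, Measurable (X t)) {σ : Ω → ℝ≥0} (hσ : Measurable σ) :
    Measurable fun ω => X (σ ω) ω :=
  (measurable_uncurry_of_continuous_of_measurable hc hm).comp (hσ.prodMk measurable_id)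

/-- The first time after a random time at which a continuous process is in a closed set is
measurable. -/
lemma measurable_hitting {X : ℝ≥0 → Ω → ℝ} (hc : ∀ ω, Continuous (X · ω))
    (hm : ∀ t, Measurable (X t)) {τ : Ω → ℝ≥0∞} (hτ : Measurable τ) {F : Set ℝ}
    (hF : IsClosed F) :
    Measurable fun ω => sInf ((fun t : ℝ≥0 => (t : ℝ≥0∞)) '' {t | τ ω ≤ t ∧ X t ω ∈ F}) := by
  rcases F.eq_empty_or_nonempty with rfl | hne
  · simp
  refine measurable_of_Iic fun c => ?_
  induction c using ENNReal.recTopCoe with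
  | top => simp
  | coe s =>
    have heq : (fun ω => sInf ((fun t : ℝ≥0 => (t : ℝ≥0∞)) '' {t | τ ω ≤ t ∧ X t ω ∈ F})) ⁻¹'
        Set.Iic (s : ℝ≥0∞) = {ω | τ ω ≤ s} ∩
          {ω | ∃ t ≤ s, Metric.infDist (X (max t (τ ω).toNNReal) ω) F = 0} := by
      ext ω
      simp only [Set.mem_preimage, Set.mem_Iic, Set.mem_inter_iff, Set.mem_ofPred_eq,
        ← hF.mem_iff_infDist_zero hne]
      have hcl : IsClosed {t : ℝ≥0 | τ ω ≤ (t : ℝ≥0∞) ∧ X t ω ∈ F} :=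
        (isClosed_le continuous_const ENNReal.continuous_coe).inter (hF.preimage (hc ω))
      constructor
      · intro h
        have htop := ne_top_of_le_ne_top ENNReal.coe_ne_top h
        obtain ⟨h1, h2⟩ := toNNReal_sInf_mem hcl htop
        rw [← ENNReal.coe_toNNReal htop] at h
        refine ⟨h1.trans h, _, by exact_mod_cast h, ?_⟩
        rwa [max_eq_left]
        simpa using ENNReal.toNNReal_mono ENNReal.coe_ne_top h1
      · rintro ⟨h1, t, hts, ht⟩
        have h1' : (τ ω).toNNReal ≤ s := by
          simpa using ENNReal.toNNReal_mono ENNReal.coe_ne_top h1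
        have hτtop := ne_top_of_le_ne_top ENNReal.coe_ne_top h1
        have hmem : max t (τ ω).toNNReal ∈ {t : ℝ≥0 | τ ω ≤ (t : ℝ≥0∞) ∧ X t ω ∈ F} := by
          refine ⟨?_, ht⟩
          rw [ENNReal.coe_max, ENNReal.coe_toNNReal hτtop]
          exact le_max_right _ _
        refine (sInf_le (Set.mem_image_of_mem _ hmem)).trans ?_
        exact_mod_cast max_le hts h1'
    rw [heq]
    refine (measurableSet_le hτ measurable_const).inter
      (measurableSet_exists_eq_zero (fun ω => ?_) (fun t => ?_)
        (fun _ _ => Metric.infDist_nonneg) s)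
    · exact (Metric.continuous_infDist_pt F).comp
        ((hc ω).comp (continuous_id.max continuous_const))
    · exact (Metric.continuous_infDist_pt F).measurable.comp
        (measurable_apply_toNNReal hc hm (measurable_const.max hτ.ennreal_toNNReal))

end Hitting

section ControlledPath

variable {Ω : Type*} [MeasurableSpace Ω] {B : ℝ≥0 → Ω → ℝ} {lo hi μ x a : ℝ}

lemma measurable_stage (hBm : ∀ t, Measurable (B t)) (hBc : ∀ ω, Continuous (B · ω)) (n : ℕ) :
    Measurable (fun ω => switchTime lo hi μ x a (B · ω) n) ∧
      ∀ t, Measurable fun ω => (stage lo hi μ x a (B · ω) n).2 t := by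
  induction n with
  | zero =>
    refine ⟨measurable_const, fun t => ?_⟩
    simp only [stage]
    fun_prop
  | succ n ih =>
    have hcont : ∀ ω, Continuous fun t => (stage lo hi μ x a (B · ω) n).2 t :=
      fun ω => continuous_stage (hBc ω) n
    have hτ : Measurable fun ω => switchTime lo hi μ x a (B · ω) (n + 1) :=
      measurable_hitting hcont ih.2 ih.1 (isClosed_switchRegion lo hi ((-1) ^ n * a))
    have hτ' := hτ.ennreal_toNNReal
    refine ⟨hτ, fun t => ?_⟩
    have h1 := measurable_apply_toNNReal hcont ih.2 hτ'
    have h2 := measurable_apply_toNNReal hBc hBm hτ'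
    exact (h1.add ((measurable_const.sub hτ'.coe_nnreal_real).const_mul _)).add ((hBm t).sub h2)

variable {δ : ℝ}

lemma measurable_uncurry_thresholdStrategy (hBm : ∀ t, Measurable (B t))
    (hBc : ∀ ω, Continuous (B · ω)) (hδ : 0 < δ) (hg : RegionGap lo hi δ) (hμ : 0 < μ)
    (ha : a = -1 ∨ a = 1) :
    Measurable fun p : ℝ≥0 × Ω => thresholdStrategy lo hi μ x a (B · p.2) p.1 := by
  have hK : Measurable fun p : ℝ≥0 × Ω =>
      sSup {n : ℕ | switchTime lo hi μ x a (B · p.2) n ≤ (p.1 : ℝ≥0∞)} := by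
    refine measurable_to_countable' fun n => ?_
    have heq : (fun p : ℝ≥0 × Ω =>
        sSup {n : ℕ | switchTime lo hi μ x a (B · p.2) n ≤ (p.1 : ℝ≥0∞)}) ⁻¹' {n} =
        {p | switchTime lo hi μ x a (B · p.2) n ≤ (p.1 : ℝ≥0∞)} ∩
          {p | (p.1 : ℝ≥0∞) < switchTime lo hi μ x a (B · p.2) (n + 1)} := by
      ext ⟨t, ω⟩
      simp only [Set.mem_preimage, Set.mem_singleton_iff, Set.mem_inter_iff, Set.mem_ofPred_eq]
      constructor
      · obtain ⟨m, hm1, hm2⟩ := exists_switchTime_le_lt (x := x) hδ hg hμ ha (hBc ω) t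
        rw [setOf_switchTime_le hm1 hm2, csSup_Iic]
        rintro rfl
        exact ⟨hm1, hm2⟩
      · rintro ⟨h1, h2⟩
        rw [setOf_switchTime_le h1 h2, csSup_Iic]
    have ht : Measurable fun p : ℝ≥0 × Ω => (p.1 : ℝ≥0∞) := measurable_fst.coe_nnreal_ennreal
    rw [heq]
    exact (measurableSet_le ((measurable_stage hBm hBc n).1.comp measurable_snd) ht).inter
      (measurableSet_lt ht ((measurable_stage hBm hBc (n + 1)).1.comp measurable_snd))
  exact (measurable_from_top (f := fun n : ℕ => (-1 : ℝ) ^ n * a)).comp hK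

lemma intervalIntegrable_of_abs_eq_one {A : ℝ≥0 → ℝ} (hA : Measurable A) (h1 : ∀ t, |A t| = 1)
    (s t : ℝ) : IntervalIntegrable (fun r => A r.toNNReal) volume s t := by
  refine (intervalIntegrable_const (c := (1 : ℝ))).mono_fun'
    (hA.comp measurable_real_toNNReal).aestronglyMeasurable (ae_of_all _ fun r => ?_)
  exact (Real.norm_eq_abs _).trans_le (h1 _).le

lemma continuous_position {w A : ℝ≥0 → ℝ} (hw : Continuous w) (hA : Measurable A)
    (h1 : ∀ t, |A t| = 1) : Continuous (position μ x w A) := by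
  have := intervalIntegral.continuous_primitive (intervalIntegrable_of_abs_eq_one hA h1) 0
  unfold position
  fun_prop

lemma measurable_thresholdStrategy_path (hw : ∀ ω, Continuous (B · ω))
    (hBm : ∀ t, Measurable (B t)) (hδ : 0 < δ) (hg : RegionGap lo hi δ) (hμ : 0 < μ)
    (ha : a = -1 ∨ a = 1) (ω : Ω) :
    Measurable (thresholdStrategy lo hi μ x a (B · ω)) :=
  (measurable_uncurry_thresholdStrategy hBm hw hδ hg hμ ha).comp
    (measurable_id.prodMk measurable_const)

lemma measurable_controlledExitTime (hBm : ∀ t, Measurable (B t))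
    (hBc : ∀ ω, Continuous (B · ω)) (hδ : 0 < δ) (hg : RegionGap lo hi δ) (hμ : 0 < μ)
    (ha : a = -1 ∨ a = 1) :
    Measurable (controlledExitTime μ x (thresholdStrategy lo hi μ x a) B) := by
  have hA := measurable_uncurry_thresholdStrategy (x := x) hBm hBc hδ hg hμ ha
  have hint (t : ℝ≥0) : Measurable fun ω => ∫ s in (0 : ℝ)..(t : ℝ),
      thresholdStrategy lo hi μ x a (B · ω) s.toNNReal := by
    simp_rw [intervalIntegral.integral_of_le t.coe_nonneg]
    refine (StronglyMeasurable.integral_prod_right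
      (f := fun (ω : Ω) (s : ℝ) => thresholdStrategy lo hi μ x a (B · ω) s.toNNReal) ?_).measurable
    exact (hA.comp ((measurable_real_toNNReal.comp measurable_snd).prodMk
      measurable_fst)).stronglyMeasurable
  have := measurable_hitting (τ := fun _ : Ω => 0) (F := (Set.Ioo (0 : ℝ) 1)ᶜ)
    (X := fun t ω => position μ x (B · ω) (thresholdStrategy lo hi μ x a (B · ω)) t)
    (fun ω => continuous_position (hBc ω)
      (measurable_thresholdStrategy_path hBc hBm hδ hg hμ ha ω) (abs_thresholdStrategy ha))
    (fun t => ((measurable_const.add ((hint t).const_mul μ)).add ((hBm t).sub (hBm 0))))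
    measurable_const isOpen_Ioo.isClosed_compl
  simpa only [zero_le, true_and] using! this

omit [MeasurableSpace Ω] in
/-- The number of switches as a sum of indicators, a form in which it is visibly measurable. -/
lemma switchesUntilExit_eq_tsum (hBc : ∀ ω, Continuous (B · ω)) (hδ : 0 < δ)
    (hg : RegionGap lo hi δ) (hμ : 0 < μ) (ha : a = -1 ∨ a = 1) (ω : Ω) :
    switchesUntilExit μ x a (thresholdStrategy lo hi μ x a) B ω =
      ∑' n : ℕ, {n : ℕ | switchTime lo hi μ x a (B · ω) (n + 1) ≤
          controlledExitTime μ x (thresholdStrategy lo hi μ x a) B ω ∧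
        switchTime lo hi μ x a (B · ω) (n + 1) ≠ ∞}.indicator 1 n := by
  rw [switchesUntilExit, numSwitches_thresholdStrategy hδ hg hμ ha (hBc ω), ← ENNReal.tsum_set_one,
    ← tsum_subtype]
  rfl

lemma measurable_switchesUntilExit (hBm : ∀ t, Measurable (B t))
    (hBc : ∀ ω, Continuous (B · ω)) (hδ : 0 < δ) (hg : RegionGap lo hi δ) (hμ : 0 < μ)
    (ha : a = -1 ∨ a = 1) :
    Measurable (switchesUntilExit μ x a (thresholdStrategy lo hi μ x a) B) := by
  have heq := funext (switchesUntilExit_eq_tsum (x := x) hBc hδ hg hμ ha)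
  rw [heq]
  have hT := measurable_controlledExitTime (x := x) hBm hBc hδ hg hμ ha
  refine Measurable.tsum fun n => ?_
  have hτ := (measurable_stage (lo := lo) (hi := hi) (μ := μ) (x := x) (a := a) hBm hBc (n + 1)).1
  exact measurable_one.indicator (s := {ω | switchTime lo hi μ x a (B · ω) (n + 1) ≤
      controlledExitTime μ x (thresholdStrategy lo hi μ x a) B ω ∧
    switchTime lo hi μ x a (B · ω) (n + 1) ≠ ∞})
    ((measurableSet_le hτ hT).inter (measurableSet_eq_fun hτ measurable_const).compl)

end ControlledPath

section Modification

variable {Ω : Type*} [MeasurableSpace Ω] {P : Measure Ω} {B : ℝ≥0 → Ω → ℝ}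

/-- A Brownian motion agrees, outside a null set, with one all of whose paths are continuous and
all of whose values are measurable. -/
lemma exists_continuous_measurable_modification (hB : IsBrownianReal B P) :
    ∃ B' : ℝ≥0 → Ω → ℝ, IsBrownianReal B' P ∧ (∀ t, Measurable (B' t)) ∧
      (∀ ω, Continuous (B' · ω)) ∧ ∀ᵐ ω ∂P, ∀ t, B t ω = B' t ω := by
  classical
  set D := TopologicalSpace.denseSeq ℝ≥0 with hD
  have hae : ∀ᵐ ω ∂P, Continuous (B · ω) ∧ ∀ k, B (D k) ω = (hB.aemeasurable (D k)).mk _ ω :=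
    hB.cont.and (ae_all_iff.2 fun k => (hB.aemeasurable (D k)).ae_eq_mk)
  obtain ⟨N, hN, hNm, hN0⟩ := exists_measurable_superset_of_null (ae_iff.1 hae)
  have hG {ω : Ω} (hω : ω ∉ N) :
      Continuous (B · ω) ∧ ∀ k, B (D k) ω = (hB.aemeasurable (D k)).mk _ ω := by
    by_contra h
    exact hω (hN h)
  have hNae : ∀ᵐ ω ∂P, ω ∉ N := measure_eq_zero_iff_ae_notMem.1 hN0
  set B' : ℝ≥0 → Ω → ℝ := fun t ω => if ω ∈ N then 0 else B t ω with hB'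
  have hcont (ω : Ω) : Continuous (B' · ω) := by
    by_cases hω : ω ∈ N
    · simp only [hB', if_pos hω]
      exact continuous_const
    · simp only [hB', if_neg hω]
      exact (hG hω).1
  have hae' : ∀ᵐ ω ∂P, ∀ t, B t ω = B' t ω := by
    filter_upwards [hNae] with ω hω t
    simp only [hB', if_neg hω]
  have hDm (k : ℕ) : Measurable (B' (D k)) := by
    have : B' (D k) = fun ω => if ω ∈ N then 0 else (hB.aemeasurable (D k)).mk _ ω := by
      ext ω
      by_cases hω : ω ∈ N
      · simp only [hB', if_pos hω]
      · simp only [hB', if_neg hω, (hG hω).2 k]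
    rw [this]
    exact Measurable.ite hNm measurable_const (hB.aemeasurable (D k)).measurable_mk
  refine ⟨B', ⟨hB.toIsPreBrownianReal.congr fun t => ?_, ae_of_all _ hcont⟩, fun t => ?_, hcont,
    hae'⟩
  · filter_upwards [hae'] with ω hω using hω t
  · obtain ⟨u, hu, hut⟩ := mem_closure_iff_seq_limit.1
      (TopologicalSpace.denseRange_denseSeq ℝ≥0 t)
    refine measurable_of_tendsto_metrizable (f := fun n => B' (u n)) (fun n => ?_)
      (tendsto_pi_nhds.2 fun ω => ((hcont ω).tendsto t).comp hut)
    obtain ⟨k, hk⟩ := hu n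
    rw [← hk]
    exact hDm k

end Modification

/-! ### Survival forces bounded increments -/

/-- Up to and including the exit time, the particle is in the closed interval. -/
lemma mem_Icc_of_le_exitTime {X : ℝ≥0 → ℝ} (hX : Continuous X) (h0 : X 0 ∈ Set.Icc (0 : ℝ) 1)
    {t : ℝ≥0} (ht : (t : ℝ≥0∞) ≤ exitTime X) : X t ∈ Set.Icc (0 : ℝ) 1 := by
  rcases eq_or_ne t 0 with rfl | ht0
  · exact h0
  have hlt : Set.Iio t ⊆ X ⁻¹' Set.Icc (0 : ℝ) 1 := by
    intro s hs
    by_contra hXs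
    have hmem : s ∈ {r | X r ∉ Set.Ioo (0 : ℝ) 1} := fun h => hXs (Set.Ioo_subset_Icc_self h)
    have hle : exitTime X ≤ s :=
      sInf_le (Set.mem_image_of_mem (fun t : ℝ≥0 => (t : ℝ≥0∞)) hmem)
    exact absurd (ht.trans hle) (not_le.2 (by exact_mod_cast hs))
  have hcl := closure_minimal hlt (isClosed_Icc.preimage hX)
  rw [closure_Iio' ⟨0, pos_iff_ne_zero.2 ht0⟩] at hcl
  exact hcl (Set.mem_Iic.2 le_rfl)

/-- The paths whose first `k` increments over time steps of length `η` are all at most `M`. -/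
def smallIncrements (η : ℝ≥0) (M : ℝ) (k : ℕ) : Set (ℝ≥0 → ℝ) :=
  {w | ∀ j < k, w (j * η + η) - w (j * η) ≤ M}

/-- An increment larger than `1 + μη` carries the particle out of the interval, whatever the
strategy does. -/
lemma mem_smallIncrements_of_le_exitTime {μ x : ℝ} (hμ : 0 < μ) (hx : x ∈ Set.Icc (0 : ℝ) 1)
    {w A : ℝ≥0 → ℝ} (hw : Continuous w) (hA : Measurable A) (h1 : ∀ t, |A t| = 1) {η : ℝ≥0}
    {k : ℕ} (hk : ((k * η : ℝ≥0) : ℝ≥0∞) ≤ exitTime (position μ x w A)) :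
    w ∈ smallIncrements η (1 + μ * η) k := by
  intro j hj
  have hX := continuous_position (μ := μ) (x := x) hw hA h1
  have h0 : position μ x w A 0 ∈ Set.Icc (0 : ℝ) 1 := by simpa [position] using hx
  have hle : (j : ℝ≥0) * η + η ≤ k * η := by
    rw [← add_one_mul]
    gcongr
    exact_mod_cast hj
  have m2 := mem_Icc_of_le_exitTime hX h0 (le_trans (by exact_mod_cast hle) hk)
  have m1 := mem_Icc_of_le_exitTime hX h0
    (le_trans (by exact_mod_cast le_self_add.trans hle) hk : ((j * η : ℝ≥0) : ℝ≥0∞) ≤ _)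
  have hsplit := intervalIntegral.integral_add_adjacent_intervals
    (intervalIntegrable_of_abs_eq_one hA h1 0 (j * η : ℝ≥0))
    (intervalIntegrable_of_abs_eq_one hA h1 (j * η : ℝ≥0) (j * η + η : ℝ≥0))
  have hbd := intervalIntegral.norm_integral_le_of_norm_le_const (C := 1)
    (f := fun r : ℝ => A r.toNNReal) (a := ((j * η : ℝ≥0) : ℝ)) (b := ((j * η + η : ℝ≥0) : ℝ))
    fun r _ => by rw [Real.norm_eq_abs, h1]
  have hη : ((j * η + η : ℝ≥0) : ℝ) - ((j * η : ℝ≥0) : ℝ) = η := by push_cast; ring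
  rw [hη, Real.norm_eq_abs, abs_of_nonneg η.coe_nonneg, one_mul] at hbd
  have hbd' := mul_le_mul_of_nonneg_left (abs_le.1 hbd).1 hμ.le
  simp only [position, ← hsplit, mul_add] at m1 m2
  linarith [m1.1, m2.2]

lemma measurableSet_smallIncrements (η : ℝ≥0) (M : ℝ) (k : ℕ) :
    MeasurableSet (smallIncrements η M k) := by
  have : smallIncrements η M k = ⋂ j ∈ Set.Iio k, {w | w (j * η + η) - w (j * η) ≤ M} := by
    ext w; simp [smallIncrements]
  rw [this]
  exact MeasurableSet.biInter (Set.to_countable _) fun j _ =>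
    measurableSet_le (by fun_prop) measurable_const

section Brownian

variable {Ω : Type*} [MeasurableSpace Ω] {P : Measure Ω} {B : ℝ≥0 → Ω → ℝ}

/-- The increments up to time `kη` are independent of the path after time `kη`. -/
lemma lintegral_smallIncrements_mul (hB : IsBrownianReal B P) (hBm : ∀ t, Measurable (B t))
    (η : ℝ≥0) (M : ℝ) (k : ℕ) {f : (ℝ≥0 → ℝ) → ℝ≥0∞} (hf : Measurable f) :
    ∫⁻ ω, (smallIncrements η M k).indicator 1 (B · ω) *
        f (fun t => B (k * η + t) ω - B (k * η) ω) ∂P =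
      P {ω | (B · ω) ∈ smallIncrements η M k} *
        ∫⁻ ω, f (fun t => B (k * η + t) ω - B (k * η) ω) ∂P := by
  have hpath : Measurable fun ω => (B · ω) := measurable_pi_lambda _ hBm
  set T : ℝ≥0 := k * η with hT
  have hS := measurableSet_smallIncrements η M k
  -- membership as a function of the path up to time `T`, continued as a constant
  have hψ : Measurable fun v : Set.Iic T → ℝ => (smallIncrements η M k).indicator (1 : (ℝ≥0 → ℝ) → ℝ≥0∞)
      (fun s => v ⟨min s T, Set.mem_Iic.2 (min_le_right s T)⟩) :=
    (measurable_one.indicator hS).comp (measurable_pi_lambda _ fun s =>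
      measurable_pi_apply (⟨min s T, Set.mem_Iic.2 (min_le_right s T)⟩ : Set.Iic T))
  have hind := (hB.indepFun_shift T).symm.comp hψ hf
  have heq : (fun v : Set.Iic T → ℝ => (smallIncrements η M k).indicator (1 : (ℝ≥0 → ℝ) → ℝ≥0∞)
      (fun s => v ⟨min s T, Set.mem_Iic.2 (min_le_right s T)⟩)) ∘
        (fun ω (t : Set.Iic T) => B t ω) =
      fun ω => (smallIncrements η M k).indicator 1 (B · ω) := by
    ext ω
    have hiff : (fun s => B (min s T) ω) ∈ smallIncrements η M k ↔
        (B · ω) ∈ smallIncrements η M k := by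
      refine forall₂_congr fun j hj => ?_
      have hle : (j : ℝ≥0) * η + η ≤ T := by
        rw [hT, ← add_one_mul]
        gcongr
        exact_mod_cast hj
      simp only [min_eq_left hle, min_eq_left (le_self_add.trans hle)]
    by_cases h : (B · ω) ∈ smallIncrements η M k
    · rw [Set.indicator_of_mem h]
      exact Set.indicator_of_mem (hiff.2 h) _
    · rw [Set.indicator_of_notMem h]
      exact Set.indicator_of_notMem (mt hiff.1 h) _
  rw [heq] at hind
  have hmul := lintegral_mul_eq_lintegral_mul_lintegral_of_indepFun''
    ((measurable_one.indicator hS).comp hpath).aemeasurable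
    (hf.comp (measurable_pi_lambda _ fun t => (hBm (T + t)).sub (hBm T))).aemeasurable hind
  have hset : ∫⁻ ω, (smallIncrements η M k).indicator (1 : (ℝ≥0 → ℝ) → ℝ≥0∞) (B · ω) ∂P =
      P {ω | (B · ω) ∈ smallIncrements η M k} :=
    lintegral_indicator_one (s := {ω | (B · ω) ∈ smallIncrements η M k}) (hpath hS)
  rw [← hset]
  exact hmul

/-- The increments over disjoint blocks are independent, so this probability is geometric. -/
lemma measure_smallIncrements_eq (hB : IsBrownianReal B P) (hBm : ∀ t, Measurable (B t))
    (η : ℝ≥0) (M : ℝ) (k : ℕ) :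
    P {ω | (B · ω) ∈ smallIncrements η M k} = gaussianReal 0 η (Set.Iic M) ^ k := by
  have : IsProbabilityMeasure P := hB.isGaussianProcess.isProbabilityMeasure
  have hpath : Measurable fun ω => (B · ω) := measurable_pi_lambda _ hBm
  induction k with
  | zero => simp [smallIncrements]
  | succ k ih =>
    have hE : MeasurableSet {v : ℝ≥0 → ℝ | v η ≤ M} :=
      measurableSet_le (measurable_pi_apply η) measurable_const
    have hmul := lintegral_smallIncrements_mul hB hBm η M k
      (f := {v : ℝ≥0 → ℝ | v η ≤ M}.indicator 1) (measurable_one.indicator hE)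
    have hlaw : ∫⁻ ω, {v : ℝ≥0 → ℝ | v η ≤ M}.indicator (1 : (ℝ≥0 → ℝ) → ℝ≥0∞)
        (fun t => B (k * η + t) ω - B (k * η) ω) ∂P = gaussianReal 0 η (Set.Iic M) := by
      have hd : Measurable fun ω => B (k * η + η) ω - B (k * η) ω := (hBm _).sub (hBm _)
      rw [← ((hB.shift (k * η)).hasLaw_eval η).map_eq, Measure.map_apply hd measurableSet_Iic]
      exact lintegral_indicator_one (s := {ω | B (k * η + η) ω - B (k * η) ω ≤ M})
        (measurableSet_le hd measurable_const)
    rw [hlaw, ih] at hmul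
    rw [pow_succ, ← hmul, ← lintegral_indicator_one
      (s := {ω | (B · ω) ∈ smallIncrements η M (k + 1)})
      (hpath (measurableSet_smallIncrements η M (k + 1)))]
    refine lintegral_congr fun ω => ?_
    have hiff : (B · ω) ∈ smallIncrements η M (k + 1) ↔
        (B · ω) ∈ smallIncrements η M k ∧ B (k * η + η) ω - B (k * η) ω ≤ M := by
      simp only [smallIncrements, Set.mem_ofPred_eq, Nat.lt_succ_iff_lt_or_eq]
      constructor
      · exact fun h => ⟨fun j hj => h j (Or.inl hj), h k (Or.inr rfl)⟩
      · rintro ⟨h1, h2⟩ j (hj | rfl)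
        · exact h1 j hj
        · exact h2
    by_cases h1 : (B · ω) ∈ smallIncrements η M k <;>
      by_cases h2 : B (k * η + η) ω - B (k * η) ω ≤ M <;>
      simp [Set.indicator, hiff, h1, h2]

lemma gaussianReal_Iic_lt_one {η : ℝ≥0} (hη : η ≠ 0) (M : ℝ) :
    gaussianReal 0 η (Set.Iic M) < 1 := by
  have hpos : 0 < gaussianReal 0 η (Set.Ioi M) := by
    refine pos_iff_ne_zero.2 fun h => ?_
    have := gaussianReal_absolutelyContinuous' 0 hη h
    simp at this
  rw [← Set.compl_Ioi, prob_compl_eq_one_sub measurableSet_Ioi]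
  exact ENNReal.sub_lt_self ENNReal.one_ne_top one_ne_zero hpos.ne'

end Brownian

/-! ### Bounds by sums over time blocks -/

/-- A time is at most the total length of the blocks that begin before or at that time. -/
lemma le_tsum_block {η : ℝ≥0} (hη : 0 < η) (T : ℝ≥0∞) :
    T ≤ ∑' k : ℕ, (η : ℝ≥0∞) * {k : ℕ | ((k * η : ℝ≥0) : ℝ≥0∞) ≤ T}.indicator 1 k := by
  have hη' : (η : ℝ≥0∞) ≠ 0 := by exact_mod_cast hη.ne'
  induction T using ENNReal.recTopCoe with
  | top => simp [ENNReal.tsum_const_eq_top_of_ne_zero hη']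
  | coe t =>
    refine le_trans ?_ (ENNReal.sum_le_tsum (Finset.range (⌊t / η⌋₊ + 1)))
    have h1 : ∀ k ∈ Finset.range (⌊t / η⌋₊ + 1),
        (η : ℝ≥0∞) * {k : ℕ | ((k * η : ℝ≥0) : ℝ≥0∞) ≤ t}.indicator 1 k = η := by
      intro k hk
      have hk' : (k : ℝ≥0) * η ≤ t := by
        rw [← le_div_iff₀ hη]
        exact (Nat.le_floor_iff zero_le).1 (Nat.lt_succ_iff.1 (Finset.mem_range.1 hk))
      rw [Set.indicator_of_mem (show k ∈ {k : ℕ | ((k * η : ℝ≥0) : ℝ≥0∞) ≤ t} by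
        exact ENNReal.coe_le_coe.2 hk')]
      simp
    rw [Finset.sum_congr rfl h1, Finset.sum_const, Finset.card_range, nsmul_eq_mul]
    have : t ≤ (⌊t / η⌋₊ + 1) * η := by
      rw [← div_le_iff₀ hη]
      exact (Nat.lt_floor_add_one _).le
    exact_mod_cast this

section Blocks

variable {lo hi μ x a δ : ℝ} {w : ℝ≥0 → ℝ}

/-- In a block so short that the drift covers at most half the gap, the path has to move by half
the gap between consecutive switches; hence there are at most `1 + oscillations` switches. -/
lemma tsum_indicator_block_le (hδ : 0 < δ) (hg : RegionGap lo hi δ) (hμ : 0 < μ)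
    (ha : a = -1 ∨ a = 1) (hw : Continuous w) {η : ℝ≥0} (hη : 0 < η) (hμη : μ * η ≤ δ / 2)
    (c : ℝ≥0) :
    ∑' n : ℕ, {n : ℕ | (c : ℝ≥0∞) ≤ switchTime lo hi μ x a w (n + 1) ∧
        switchTime lo hi μ x a w (n + 1) < c + η}.indicator (1 : ℕ → ℝ≥0∞) n ≤
      1 + oscillations (δ / 8) η (fun t => w (c + t) - w c) := by
  classical
  set τ := switchTime lo hi μ x a w with hτ
  have hτmono : Monotone τ := switchTime_mono
  rw [ENNReal.tsum_eq_iSup_sum]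
  refine iSup_le fun F => ?_
  rw [Finset.sum_indicator_eq_sum_filter]
  simp only [Pi.one_apply, Finset.sum_const, nsmul_eq_mul, mul_one]
  set F' := F.filter (· ∈ {n : ℕ | (c : ℝ≥0∞) ≤ τ (n + 1) ∧ τ (n + 1) < c + η}) with hF'
  rcases F'.eq_empty_or_nonempty with hemp | hne
  · simp [hemp]
  set n₀ := F'.min' hne
  set n₁ := F'.max' hne
  have hn₀ : (c : ℝ≥0∞) ≤ τ (n₀ + 1) := (Finset.mem_filter.1 (F'.min'_mem hne)).2.1
  have hn₁ : τ (n₁ + 1) < c + η := (Finset.mem_filter.1 (F'.max'_mem hne)).2.2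
  have hle : n₀ ≤ n₁ := F'.min'_le _ (F'.max'_mem hne)
  have hcard : F'.card ≤ 1 + (n₁ - n₀) := by
    have : F' ⊆ Finset.Icc n₀ n₁ := fun n hn =>
      Finset.mem_Icc.2 ⟨F'.min'_le n hn, F'.le_max' n hn⟩
    have := Finset.card_le_card this
    rw [Nat.card_Icc] at this
    omega
  have hrange (i : ℕ) (hi : i ≤ n₁ - n₀) :
      c ≤ (τ (n₀ + i + 1)).toNNReal ∧ (τ (n₀ + i + 1)).toNNReal ≤ c + η ∧ τ (n₀ + i + 1) ≠ ∞ := by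
    have h1 : (c : ℝ≥0∞) ≤ τ (n₀ + i + 1) := hn₀.trans (hτmono (by omega))
    have h2 : τ (n₀ + i + 1) < c + η := (hτmono (by omega)).trans_lt hn₁
    have h3 : τ (n₀ + i + 1) ≠ ∞ := h2.ne_top
    rw [← ENNReal.coe_toNNReal h3] at h1 h2
    exact ⟨by exact_mod_cast h1, by exact_mod_cast h2.le, h3⟩
  have hosc : ((n₁ - n₀ : ℕ) : ℝ≥0∞) ≤ oscillations (δ / 8) η (fun t => w (c + t) - w c) := by
    refine le_oscillations (by positivity) hη (by fun_prop) (n₁ - n₀)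
      (fun i => (τ (n₀ + i + 1)).toNNReal - c) (fun i hi => ?_) (fun i hi => ?_) (fun i hi => ?_)
    · exact tsub_le_tsub_right (ENNReal.toNNReal_mono (hrange (i + 1) hi).2.2
        (hτmono (by omega))) c
    · exact tsub_le_iff_left.2 (hrange i hi).2.1
    · have r1 := hrange i hi.le
      have r2 := hrange (i + 1) hi
      have hmove := le_abs_sub_switchTime (x := x) hg hμ ha hw (n := n₀ + i) r2.2.2
      simp only [add_tsub_cancel_of_le r1.1, add_tsub_cancel_of_le r2.1, sub_sub_sub_cancel_right]
      have hd : ((τ (n₀ + i + 2)).toNNReal : ℝ) - ((τ (n₀ + i + 1)).toNNReal : ℝ) ≤ η := by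
        have h1 : (c : ℝ) ≤ (τ (n₀ + i + 1)).toNNReal := r1.1
        have h2 : ((τ (n₀ + i + 2)).toNNReal : ℝ) ≤ c + η := r2.2.1
        linarith
      have hd' := mul_le_mul_of_nonneg_left hd hμ.le
      have e : n₀ + (i + 1) + 1 = n₀ + i + 2 := by ring
      rw [e]
      linarith
  calc (F'.card : ℝ≥0∞) ≤ ((1 + (n₁ - n₀) : ℕ) : ℝ≥0∞) := by exact_mod_cast hcard
    _ = 1 + ((n₁ - n₀ : ℕ) : ℝ≥0∞) := by push_cast; rfl
    _ ≤ _ := by gcongr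

/-- Every switching time up to `T` lies in a block that begins before or at `T`. -/
lemma tsum_indicator_switchTime_le (hδ : 0 < δ) (hg : RegionGap lo hi δ) (hμ : 0 < μ)
    (ha : a = -1 ∨ a = 1) (hw : Continuous w) {η : ℝ≥0} (hη : 0 < η) (hμη : μ * η ≤ δ / 2)
    (T : ℝ≥0∞) :
    ∑' n : ℕ, {n : ℕ | switchTime lo hi μ x a w (n + 1) ≤ T ∧
        switchTime lo hi μ x a w (n + 1) ≠ ∞}.indicator (1 : ℕ → ℝ≥0∞) n ≤
      ∑' k : ℕ, {k : ℕ | ((k * η : ℝ≥0) : ℝ≥0∞) ≤ T}.indicator 1 k *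
        (1 + oscillations (δ / 8) η (fun t => w (k * η + t) - w (k * η))) := by
  have hpt (n : ℕ) : {n : ℕ | switchTime lo hi μ x a w (n + 1) ≤ T ∧
        switchTime lo hi μ x a w (n + 1) ≠ ∞}.indicator (1 : ℕ → ℝ≥0∞) n ≤
      ∑' k : ℕ, {k : ℕ | ((k * η : ℝ≥0) : ℝ≥0∞) ≤ T}.indicator 1 k *
        {n : ℕ | ((k * η : ℝ≥0) : ℝ≥0∞) ≤ switchTime lo hi μ x a w (n + 1) ∧
          switchTime lo hi μ x a w (n + 1) < ((k * η : ℝ≥0) : ℝ≥0∞) + η}.indicator 1 n := by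
    by_cases hn : switchTime lo hi μ x a w (n + 1) ≤ T ∧ switchTime lo hi μ x a w (n + 1) ≠ ∞
    · obtain ⟨k, h1, h2⟩ : ∃ k : ℕ,
          ((k * η : ℝ≥0) : ℝ≥0∞) ≤ switchTime lo hi μ x a w (n + 1) ∧
            switchTime lo hi μ x a w (n + 1) < ((k * η : ℝ≥0) : ℝ≥0∞) + η := by
        rw [← ENNReal.coe_toNNReal hn.2]
        refine ⟨⌊(switchTime lo hi μ x a w (n + 1)).toNNReal / η⌋₊, ?_, ?_⟩
        · rw [ENNReal.coe_le_coe, ← le_div_iff₀ hη]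
          exact Nat.floor_le zero_le
        · rw [← ENNReal.coe_add, ENNReal.coe_lt_coe, ← add_one_mul, ← div_lt_iff₀ hη]
          exact Nat.lt_floor_add_one _
      have hk : k ∈ {k : ℕ | ((k * η : ℝ≥0) : ℝ≥0∞) ≤ T} := h1.trans hn.1
      have hn' : n ∈ {n : ℕ | ((k * η : ℝ≥0) : ℝ≥0∞) ≤ switchTime lo hi μ x a w (n + 1) ∧
          switchTime lo hi μ x a w (n + 1) < ((k * η : ℝ≥0) : ℝ≥0∞) + η} := ⟨h1, h2⟩
      refine le_trans ?_ (ENNReal.le_tsum k)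
      rw [Set.indicator_of_mem hk, Set.indicator_of_mem hn']
      simp only [Pi.one_apply, mul_one]
      exact Set.indicator_le_self' (fun _ _ => zero_le) n
    · rw [Set.indicator_of_notMem (a := n) hn]
      exact zero_le
  refine (ENNReal.tsum_le_tsum hpt).trans ?_
  rw [ENNReal.tsum_comm]
  refine ENNReal.tsum_le_tsum fun k => ?_
  rw [ENNReal.tsum_mul_left]
  gcongr
  exact tsum_indicator_block_le hδ hg hμ ha hw hη hμη _

end Blocks

/-! ### Finite expectations -/

/-- A threshold strategy whose two switching regions are separated has an exit time and a number of
switches of finite expectation. -/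
theorem hasFiniteExpectation_thresholdStrategy {Ω : Type*} [MeasurableSpace Ω] {P : Measure Ω}
    {B : ℝ≥0 → Ω → ℝ} (hB : IsBrownianReal B P) {lo hi μ x a : ℝ} (hμ : 0 < μ)
    (hlohi : hi < 1 / 2 ∨ 1 / 2 < lo) (hx : x ∈ Set.Icc (0 : ℝ) 1) (ha : a = -1 ∨ a = 1) :
    HasFiniteExpectation P (controlledExitTime μ x (thresholdStrategy lo hi μ x a) B) ∧
      HasFiniteExpectation P (switchesUntilExit μ x a (thresholdStrategy lo hi μ x a) B) := by
  obtain ⟨δ, hδ, hg⟩ := exists_regionGap hlohi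
  obtain ⟨B', hB', hm, hc, hae⟩ := exists_continuous_measurable_modification hB
  have hpath {ω : Ω} (hω : ∀ t, B t ω = B' t ω) : (fun t => B t ω) = fun t => B' t ω := funext hω
  have e1 : controlledExitTime μ x (thresholdStrategy lo hi μ x a) B' =ᵐ[P]
      controlledExitTime μ x (thresholdStrategy lo hi μ x a) B := by
    filter_upwards [hae] with ω hω
    rw [controlledExitTime, controlledExitTime, hpath hω]
  have e2 : switchesUntilExit μ x a (thresholdStrategy lo hi μ x a) B' =ᵐ[P]
      switchesUntilExit μ x a (thresholdStrategy lo hi μ x a) B := by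
    filter_upwards [hae, e1] with ω hω h1
    rw [switchesUntilExit, switchesUntilExit, hpath hω, h1]
  have m1 := measurable_controlledExitTime (x := x) hm hc hδ hg hμ ha
  have m2 := measurable_switchesUntilExit (x := x) hm hc hδ hg hμ ha
  have hP : IsProbabilityMeasure P := hB.isGaussianProcess.isProbabilityMeasure
  have hpathm : Measurable fun ω => (B' · ω) := measurable_pi_lambda _ hm
  -- blocks of length `η`, during which the drift covers at most half the gap
  obtain ⟨η, hη, hμη⟩ : ∃ η : ℝ≥0, 0 < η ∧ μ * η ≤ δ / 2 := by
    refine ⟨(δ / (2 * μ)).toNNReal, Real.toNNReal_pos.2 (by positivity), ?_⟩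
    rw [Real.coe_toNNReal _ (by positivity)]
    exact (by field_simp : μ * (δ / (2 * μ)) = δ / 2).le
  set S := smallIncrements η (1 + μ * η) with hS
  set q := gaussianReal 0 η (Set.Iic (1 + μ * η)) with hq
  have hq1 : q < 1 := gaussianReal_Iic_lt_one hη.ne' _
  have hgeom : ∑' k : ℕ, q ^ k < ∞ := by
    rw [ENNReal.tsum_geometric, ENNReal.inv_lt_top]
    exact tsub_pos_of_lt hq1
  have hsurv (k : ℕ) (ω : Ω) :
      {k : ℕ | ((k * η : ℝ≥0) : ℝ≥0∞) ≤
        controlledExitTime μ x (thresholdStrategy lo hi μ x a) B' ω}.indicator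
          (1 : ℕ → ℝ≥0∞) k ≤ (S k).indicator 1 (B' · ω) := by
    by_cases hk : ((k * η : ℝ≥0) : ℝ≥0∞) ≤
        controlledExitTime μ x (thresholdStrategy lo hi μ x a) B' ω
    · rw [Set.indicator_of_mem (mem_smallIncrements_of_le_exitTime hμ hx (hc ω)
        (measurable_thresholdStrategy_path hc hm hδ hg hμ ha ω) (abs_thresholdStrategy ha) hk)]
      exact Set.indicator_le_self' (fun _ _ => zero_le) k
    · rw [Set.indicator_of_notMem (a := k) hk]
      exact zero_le
  refine ⟨⟨⟨_, m1, e1.symm⟩, ?_⟩, ⟨⟨_, m2, e2.symm⟩, ?_⟩⟩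
  · rw [← lintegral_congr_ae e1]
    calc ∫⁻ ω, controlledExitTime μ x (thresholdStrategy lo hi μ x a) B' ω ∂P
        ≤ ∫⁻ ω, ∑' k : ℕ, (η : ℝ≥0∞) * (S k).indicator 1 (B' · ω) ∂P := by
          refine lintegral_mono fun ω => (le_tsum_block hη _).trans
            (ENNReal.tsum_le_tsum fun k => ?_)
          gcongr
          exact hsurv k ω
      _ = ∑' k : ℕ, (η : ℝ≥0∞) * q ^ k := by
          have hSm (k : ℕ) : Measurable fun ω => (S k).indicator (1 : (ℝ≥0 → ℝ) → ℝ≥0∞) (B' · ω) :=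
            (measurable_one.indicator (measurableSet_smallIncrements _ _ k)).comp hpathm
          rw [lintegral_tsum fun k => ((hSm k).const_mul _).aemeasurable]
          refine tsum_congr fun k => ?_
          rw [lintegral_const_mul _ (hSm k), ← measure_smallIncrements_eq hB' hm]
          congr 1
          exact lintegral_indicator_one (s := {ω | (B' · ω) ∈ S k})
            (hpathm (measurableSet_smallIncrements _ _ k))
      _ < ∞ := by
          rw [ENNReal.tsum_mul_left]
          exact ENNReal.mul_lt_top ENNReal.coe_lt_top hgeom
  · rw [← lintegral_congr_ae e2]
    set K : ℝ≥0∞ := 1 + ENNReal.ofReal (η / (δ / 8) ^ 2) with hK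
    have hfm : Measurable fun v => 1 + oscillations (δ / 8) η v :=
      (measurable_oscillations _ _).const_add 1
    calc ∫⁻ ω, switchesUntilExit μ x a (thresholdStrategy lo hi μ x a) B' ω ∂P
        ≤ ∫⁻ ω, ∑' k : ℕ, (S k).indicator 1 (B' · ω) *
            (1 + oscillations (δ / 8) η (fun t => B' (k * η + t) ω - B' (k * η) ω)) ∂P := by
          refine lintegral_mono fun ω => ?_
          rw [switchesUntilExit_eq_tsum hc hδ hg hμ ha]
          refine (tsum_indicator_switchTime_le hδ hg hμ ha (hc ω) hη hμη _).trans
            (ENNReal.tsum_le_tsum fun k => ?_)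
          gcongr
          exact hsurv k ω
      _ = ∑' k : ℕ, q ^ k *
            ∫⁻ ω, (1 + oscillations (δ / 8) η (fun t => B' (k * η + t) ω - B' (k * η) ω)) ∂P := by
          rw [lintegral_tsum fun k => ?_]
          · refine tsum_congr fun k => ?_
            rw [lintegral_smallIncrements_mul hB' hm η _ k hfm, measure_smallIncrements_eq hB' hm]
          · refine Measurable.aemeasurable (Measurable.mul ?_ ?_)
            · exact (measurable_one.indicator (measurableSet_smallIncrements _ _ k)).comp hpathm
            · exact hfm.comp (measurable_pi_lambda _ fun t => (hm (k * η + t)).sub (hm (k * η)))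
      _ ≤ ∑' k : ℕ, q ^ k * K := by
          refine ENNReal.tsum_le_tsum fun k => ?_
          gcongr
          rw [lintegral_add_left measurable_const, lintegral_one, measure_univ]
          refine add_le_add le_rfl ?_
          exact lintegral_oscillations_le (hB'.shift (k * η))
            (fun t => (hm (k * η + t)).sub (hm (k * η))) (by positivity) η
      _ < ∞ := by
          rw [ENNReal.tsum_mul_right]
          exact ENNReal.mul_lt_top hgeom (by simp [hK])

end DriftSwitching

theorem proposition2 {Ω : Type*} [MeasurableSpace Ω] (P : Measure Ω)
    (B : ℝ≥0 → Ω → ℝ) (hB : IsBrownianReal B P)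
    (μ c : ℝ) (hμ : 0 < μ) (hc : 0 < c) (hcle : c ≤ DriftSwitching.criticalCost μ)
    (x a : ℝ) (hx : x ∈ Set.Icc (0 : ℝ) 1) (ha : a = -1 ∨ a = 1) :
    (DriftSwitching.HasFiniteExpectation P
        (DriftSwitching.controlledExitTime μ x (DriftSwitching.expulsion μ c x a) B) ∧
      DriftSwitching.HasFiniteExpectation P
        (DriftSwitching.switchesUntilExit μ x a (DriftSwitching.expulsion μ c x a) B)) ∧
    (DriftSwitching.HasFiniteExpectation P
        (DriftSwitching.controlledExitTime μ x (DriftSwitching.confinement μ c x a) B) ∧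
      DriftSwitching.HasFiniteExpectation P
        (DriftSwitching.switchesUntilExit μ x a (DriftSwitching.confinement μ c x a) B)) := by
  have hb := DriftSwitching.barrierB_lt_half hμ hc hcle
  constructor
  · exact DriftSwitching.hasFiniteExpectation_thresholdStrategy hB hμ (Or.inl hb) hx ha
  · refine DriftSwitching.hasFiniteExpectation_thresholdStrategy hB hμ (Or.inr ?_) hx ha
    rw [DriftSwitching.barrierAMax]
    linarith
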